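/- Let $\mathcal G$ be a connected, locally finite simple graph with countable vertex set, each edge $e$ of which is identified with an interval $[0,\ell_e]$, $0<\ell_e<\infty$. Give $\mathcal G$ the geodesic distance (infimum of the lengths of paths) and let $\overline{\mathcal G}$ be its metric completion. Let $\partial\overline{\mathcal G}$ be the set consisting of the vertices with exactly one incident edge and of all points of $\overline{\mathcal G}\setminus\mathcal G$. Assume that $\overline{\mathcal G}$ is compact and weakly connected: for any two distinct points $x,y\in\overline{\mathcal G}$ there are a finite set $W\subset\mathcal G$ and disjoint open sets $A\ni x$, $B\ni y$ with $\overline{\mathcal G}\setminus W=A\cup B$. Let $q:\mathcal G\to[0,\infty)$ be integrable over $\mathcal G$, and assume that there are weights $\omega(e)>0$ with $\sum_e\omega(e)<\infty$ and $\sum_e\int_e(\omega(e)^{-1}q)^2\,\omega(e)\,dx<\infty$. A function $u$ on $\mathcal G$ is $q$-harmonic if it is continuous, if on each edge $u'$ is absolutely continuous and $u''=qu$ almost everywhere, and if at each vertex $v$ of degree at least two the derivatives of $u$ at $v$ along the incident edges, taken in the direction from $v$ into the edge, sum to $0$. A $q$-harmonic extension of $U:\partial\overline{\mathcal G}\to\mathbb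 R$ is a continuous function $u$ on $\overline{\mathcal G}$ that is $q$-harmonic on $\mathcal G$ and equals $U$ on $\partial\overline{\mathcal G}$. Let $\mathcal A$ be the set of continuous $\phi:\overline{\mathcal G}\to\mathbb R$ that are infinitely differentiable on the open edges and satisfy $\phi'=0$ off a finite set of edges and in a neighborhood of each vertex. For continuous $U:\partial\overline{\mathcal G}\to\mathbb R$ and clopen $\Omega\subset\partial\overline{\mathcal G}$ put $$\Lambda_q(U,\Omega)=\int_{\mathcal G}u\,L\phi,\qquad L\phi=-\phi''+q\phi,$$ where $u$ is the $q$-harmonic extension of $U$ and $\phi\in\mathcal A$ is any function with $\phi=1$ on $\Omega$ and $\phi=0$ on $\partial\overline{\mathcal G}\setminus\Omega$. Then for all nonempty clopen subsets $\Omega(1),\Omega(2)$ of $\partial\overline{\mathcal G}$, both values below are well defined (the $q$-harmonic extension exists and is unique, such a $\phi$ exists, and the integral converges absolutely to a value that does not depend on $\phi$), and $$\Lambda_q(1_{\Omega(1)},\Omega(2))=\Lambda_q(1_{\Omega(2)},\Omega(1)).$$ -/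

import Mathlib

open Set Filter Topology MeasureTheory

/-- A connected, locally finite (simple) graph on the vertex set `V`, each of whose edges `e` is
identified with the real interval `[0, len e]`.  The coordinate `0` stands for the endpoint `src e`
and the coordinate `len e` for the endpoint `tgt e`. -/
structure MetricGraph (V : Type*) where
  graph : SimpleGraph V
  connected : graph.Connected
  locallyFinite : ∀ v, (graph.neighborSet v).Finite
  len : graph.edgeSet → ℝ
  len_pos : ∀ e, 0 < len e
  src : graph.edgeSet → V
  tgt : graph.edgeSet → V
  ends : ∀ e : graph.edgeSet, s(src e, tgt e) = (e : Sym2 V)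

namespace MetricGraph

variable {V : Type*}

/-- The type of edges. -/
abbrev Edge (G : MetricGraph V) : Type _ := G.graph.edgeSet

/-- A point of the metric graph, given by an edge and a coordinate on it.  The several
descriptions of a vertex (one for each incident edge) are at distance `0` from each other, and so
become one point in the completion. -/
@[ext] structure Point (G : MetricGraph V) where
  edge : G.Edge
  pos : ℝ
  nonneg : 0 ≤ pos
  le_len : pos ≤ G.len edge

/-- The point `x` is the vertex `v`. -/
def Point.IsVertex {G : MetricGraph V} (x : G.Point) (v : V) : Prop :=
  (x.pos = 0 ∧ G.src x.edge = v) ∨ (x.pos = G.len x.edge ∧ G.tgt x.edge = v)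

/-- `G.Path x y L`: there is a path of length `L` from `x` to `y`, that is, a finite concatenation
of segments of edges, where one may pass from one edge to another at a common vertex. -/
inductive Path (G : MetricGraph V) : G.Point → G.Point → ℝ → Prop
  | nil (x : G.Point) : Path G x x 0
  | seg {x y z : G.Point} {L : ℝ} (h : x.edge = y.edge) (p : Path G y z L) :
      Path G x z (|x.pos - y.pos| + L)
  | turn {x y z : G.Point} {L : ℝ} (v : V) (hx : x.IsVertex v) (hy : y.IsVertex v)
      (p : Path G y z L) : Path G x z L

namespace Path

variable {G : MetricGraph V}

theorem nonneg {x y : G.Point} {L : ℝ} (p : G.Path x y L) : 0 ≤ L := by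
  induction p with
  | nil x => exact le_rfl
  | seg h p ih => positivity
  | turn v hx hy p ih => exact ih

theorem append {x y z : G.Point} {L M : ℝ} (p : G.Path x y L) (r : G.Path y z M) :
    G.Path x z (L + M) := by
  induction p with
  | nil x => simpa using r
  | seg h p ih => rw [add_assoc]; exact seg h (ih r)
  | turn v hx hy p ih => exact turn v hx hy (ih r)

theorem reverse {x y : G.Point} {L : ℝ} (p : G.Path x y L) : G.Path y x L := by
  induction p with
  | nil x => exact nil x
  | @seg x y z L h p ih =>
    have := ih.append (seg h.symm (nil x))
    rwa [add_zero, abs_sub_comm, add_comm] at this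
  | @turn x y z L v hx hy p ih =>
    have := ih.append (turn v hy hx (nil x))
    rwa [add_zero] at this

end Path

theorem exists_path_of_walk (G : MetricGraph V) {a b : V} (w : G.graph.Walk a b) :
    ∀ x y : G.Point, x.IsVertex a → y.IsVertex b → ∃ L, G.Path x y L := by
  induction w with
  | nil => intro x y hx hy; exact ⟨_, .turn _ hx hy (.nil y)⟩
  | @cons a c b h w ih =>
    intro x y hx hy
    let e : G.Edge := ⟨s(a, c), h⟩
    let p : G.Point := ⟨e, 0, le_rfl, (G.len_pos e).le⟩
    let r : G.Point := ⟨e, G.len e, (G.len_pos e).le, le_rfl⟩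
    have he : s(G.src e, G.tgt e) = s(a, c) := G.ends e
    rcases Sym2.eq_iff.1 he with ⟨h1, h2⟩ | ⟨h1, h2⟩
    · obtain ⟨L, hL⟩ := ih r y (Or.inr ⟨rfl, h2⟩) hy
      exact ⟨_, .turn a hx (y := p) (Or.inl ⟨rfl, h1⟩) (.seg (y := r) rfl hL)⟩
    · obtain ⟨L, hL⟩ := ih p y (Or.inl ⟨rfl, h1⟩) hy
      exact ⟨_, .turn a hx (y := r) (Or.inr ⟨rfl, h2⟩) (.seg (y := p) rfl hL)⟩

theorem exists_path (G : MetricGraph V) (x y : G.Point) : ∃ L, G.Path x y L := by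
  obtain ⟨w⟩ := G.connected.preconnected (G.src x.edge) (G.src y.edge)
  let p : G.Point := ⟨x.edge, 0, le_rfl, (G.len_pos _).le⟩
  let r : G.Point := ⟨y.edge, 0, le_rfl, (G.len_pos _).le⟩
  obtain ⟨L, hL⟩ := G.exists_path_of_walk w p r (Or.inl ⟨rfl, rfl⟩) (Or.inl ⟨rfl, rfl⟩)
  exact ⟨_, .seg (y := p) rfl (hL.append (.seg (y := y) rfl (.nil y)))⟩

/-- The geodesic distance: the infimum of the lengths of the paths between two points. -/
noncomputable instance (G : MetricGraph V) : PseudoMetricSpace G.Point where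
  dist x y := sInf {L | G.Path x y L}
  dist_self x := le_antisymm
    (csInf_le ⟨0, fun _ h => Path.nonneg h⟩ (Path.nil x))
    (Real.sInf_nonneg fun _ h => Path.nonneg h)
  dist_comm x y := by
    congr 1
    ext L
    exact ⟨Path.reverse, Path.reverse⟩
  dist_triangle x y z := by
    refine le_of_forall_pos_lt_add fun ε hε => ?_
    obtain ⟨L, hL, hL'⟩ := Real.lt_sInf_add_pos (s := {L | G.Path x y L})
      (G.exists_path x y) (half_pos hε)
    obtain ⟨M, hM, hM'⟩ := Real.lt_sInf_add_pos (s := {L | G.Path y z L})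
      (G.exists_path y z) (half_pos hε)
    have h := csInf_le (s := {L | G.Path x z L}) ⟨0, fun _ h => Path.nonneg h⟩ (Path.append hL hM)
    linarith

/-- The completion of the metric graph (a complete metric space). -/
abbrev Compl (G : MetricGraph V) : Type _ := UniformSpace.Completion G.Point

/-- The metric graph itself, as a subset of its completion. -/
def carrier (G : MetricGraph V) : Set G.Compl := range ((↑) : G.Point → G.Compl)

/-- The boundary of the completion: the boundary vertices (those with a single incident edge)
together with the points of the completion outside of the graph. -/
def boundary (G : MetricGraph V) : Set G.Compl :=
  {z | ∃ (v : V) (x : G.Point), (G.graph.neighborSet v).ncard = 1 ∧ x.IsVertex v ∧ z = x} ∪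
    G.carrierᶜ

/-- Any two distinct points of the completion are separated by finitely many points of the
graph. -/
def WeaklyConnected (G : MetricGraph V) : Prop :=
  ∀ x y : G.Compl, x ≠ y → ∃ W : Set G.Compl, W.Finite ∧ W ⊆ G.carrier ∧
    ∃ A B : Set G.Compl, IsOpen A ∧ IsOpen B ∧ Disjoint A B ∧ Wᶜ = A ∪ B ∧ x ∈ A ∧ y ∈ B

/-- The point of the edge `e` with coordinate `t ∈ [0, len e]` (other `t` are first moved to the
nearest endpoint of that interval). -/
noncomputable def pt (G : MetricGraph V) (e : G.Edge) (t : ℝ) : G.Compl :=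
  ((⟨e, max 0 (min t (G.len e)), le_max_left _ _,
    max_le (G.len_pos e).le (min_le_right _ _)⟩ : G.Point) : G.Compl)

/-- The restriction of a function to the edge `e`, as a function of the coordinate. -/
noncomputable def onEdge (G : MetricGraph V) (f : G.Compl → ℝ) (e : G.Edge) : ℝ → ℝ :=
  fun t => f (G.pt e t)

/-- Integrability with respect to the Lebesgue measure of the metric graph of a function that is
given on each edge `e` as a function of the coordinate in `(0, len e)`. -/
def IntegrableOnGraph (G : MetricGraph V) (F : G.Edge → ℝ → ℝ) : Prop :=
  (∀ e, IntegrableOn (F e) (Ioo 0 (G.len e))) ∧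
    Summable fun e => ∫ t in Ioo 0 (G.len e), |F e t|

/-- The integral with respect to the Lebesgue measure of the metric graph. -/
noncomputable def graphIntegral (G : MetricGraph V) (F : G.Edge → ℝ → ℝ) : ℝ :=
  ∑' e, ∫ t in Ioo 0 (G.len e), F e t

/-- The derivative of `u` along the edge `e` at its endpoint `v`, in the coordinate that increases
from `v` into the edge. -/
noncomputable def vertexDeriv (G : MetricGraph V) (u : G.Compl → ℝ) (v : V) (e : G.Edge) : ℝ :=
  open Classical in
  if G.src e = v then derivWithin (G.onEdge u e) (Icc 0 (G.len e)) 0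
  else -derivWithin (G.onEdge u e) (Icc 0 (G.len e)) (G.len e)

/-- `u` is continuous on the completion and `q`-harmonic on the graph: on each edge `u` has an
absolutely continuous derivative and `u'' = q u` almost everywhere, and at each vertex of degree
at least two the derivatives along the incident edges sum to zero. -/
structure IsQHarmonic (G : MetricGraph V) (q : G.Edge → ℝ → ℝ) (u : G.Compl → ℝ) : Prop where
  continuous : Continuous u
  equation : ∀ e : G.Edge, ∃ w : ℝ → ℝ, AbsolutelyContinuousOnInterval w 0 (G.len e) ∧
    (∀ t ∈ Icc 0 (G.len e), HasDerivWithinAt (G.onEdge u e) (w t) (Icc 0 (G.len e)) t) ∧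
    ∀ᵐ t ∂(volume.restrict (Ioo 0 (G.len e))), HasDerivAt w (q e t * G.onEdge u e t) t
  vertex : ∀ v : V, 2 ≤ (G.graph.neighborSet v).ncard →
    ∑ᶠ e ∈ {e : G.Edge | v ∈ (e : Sym2 V)}, G.vertexDeriv u v e = 0

/-- `u` is a `q`-harmonic extension of the boundary function `U`. -/
def IsExtension (G : MetricGraph V) (q : G.Edge → ℝ → ℝ) (U : G.boundary → ℝ)
    (u : G.Compl → ℝ) : Prop :=
  G.IsQHarmonic q u ∧ ∀ z : G.boundary, u z = U z

/-- The algebra of eventually flat functions: continuous on the completion, infinitely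
differentiable on the open edges, with zero derivative off a finite set of edges and in a
neighborhood of each vertex. -/
structure IsEventuallyFlat (G : MetricGraph V) (φ : G.Compl → ℝ) : Prop where
  continuous : Continuous φ
  smooth : ∀ e : G.Edge, ContDiffOn ℝ ((⊤ : ℕ∞) : WithTop ℕ∞) (G.onEdge φ e) (Ioo 0 (G.len e))
  flat_off : ∃ S : Set G.Edge, S.Finite ∧
    ∀ e ∉ S, ∀ t ∈ Ioo 0 (G.len e), deriv (G.onEdge φ e) t = 0
  flat_near : ∀ e : G.Edge, ∃ ε > 0, ∀ t ∈ Ioo 0 (G.len e),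
    t < ε ∨ G.len e - ε < t → deriv (G.onEdge φ e) t = 0

/-- `φ` is an eventually flat function which is `1` on `Ω` and `0` on the rest of the boundary. -/
def IsTestFunction (G : MetricGraph V) (Ω : Set G.boundary) (φ : G.Compl → ℝ) : Prop :=
  G.IsEventuallyFlat φ ∧ (∀ z ∈ Ω, φ (z : G.Compl) = 1) ∧ ∀ z ∉ Ω, φ (z : G.Compl) = 0

/-- The function `u Lφ`, where `Lφ = -φ'' + q φ`, on each edge. -/
noncomputable def mulL (G : MetricGraph V) (q : G.Edge → ℝ → ℝ) (u φ : G.Compl → ℝ) :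
    G.Edge → ℝ → ℝ :=
  fun e t => G.onEdge u e t *
    (-deriv (deriv (G.onEdge φ e)) t + q e t * G.onEdge φ e t)

/-- `c` is the well-defined value of the Dirichlet-Neumann function at `(U, Ω)`: there is exactly
one `q`-harmonic extension `u` of `U`, there is a test function `φ` for `Ω`, and
`∫ u Lφ` converges absolutely to `c` whichever test function `φ` is taken. -/
def IsDNValue (G : MetricGraph V) (q : G.Edge → ℝ → ℝ) (U : G.boundary → ℝ) (Ω : Set G.boundary)
    (c : ℝ) : Prop :=
  (∃! u, G.IsExtension q U u) ∧ (∃ φ, G.IsTestFunction Ω φ) ∧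
    ∀ u φ, G.IsExtension q U u → G.IsTestFunction Ω φ →
      G.IntegrableOnGraph (G.mulL q u φ) ∧ G.graphIntegral (G.mulL q u φ) = c

/-- The Dirichlet-Neumann function is well defined at `(U, Ω)`. -/
def DNDefined (G : MetricGraph V) (q : G.Edge → ℝ → ℝ) (U : G.boundary → ℝ)
    (Ω : Set G.boundary) : Prop :=
  ∃ c, G.IsDNValue q U Ω c

/-- The Dirichlet-Neumann function `Λ_q(U, Ω) = ∫ u Lφ` (and `0` where it is not well defined). -/
noncomputable def DN (G : MetricGraph V) (q : G.Edge → ℝ → ℝ) (U : G.boundary → ℝ)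
    (Ω : Set G.boundary) : ℝ :=
  open Classical in if h : G.DNDefined q U Ω then h.choose else 0

end MetricGraph

/-! On each edge a q-harmonic function is determined by its values at the two endpoints, so
everything is encoded in functions on the vertices. By Green's formula the boundary form `u'(ℓ) v(ℓ)
- u'(0) v(0)` of two solutions on an edge equals `∫ (u' v' + q u v)`. It is symmetric and
nonnegative, hence a sum of two squares in the endpoint values (`exists_isSol_basis`). Collecting
these squares over all edges embeds the vertex functions of finite energy in the Hilbert space
`EnergySpace`, whose inner product is the sum of the boundary forms (`inner_emb`).

Let `zeroSpace` be the closure of the finitely supported vertex functions that vanish at the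
boundary vertices. A test function `φ` is constant on all but finitely many edges and `q` is
integrable, so its vertex values give an element `p` of the energy space. Split `p = s + r` with `s`
in `zeroSpace` and `r` orthogonal to it. Orthogonality to the point mass at a vertex of degree at
least two is the derivative condition there, and `s` vanishes at the boundary, so `r` represents the
q-harmonic extension of the boundary values of `φ` (`exists_isExtension`). If `r₁` belongs to one
clopen set and `p₂ = s₂ + r₂` to the other, Green's formula on each edge gives `∫ u₁ Lφ₂ = ⟨r₁, p₂⟩
= ⟨r₁, r₂⟩`, which is independent of `φ₂` and symmetric (`graphIntegral_mulL`, `isDNValue_inner`).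

Three facts support this. The Hölder bound `|u x - u y|² ≤ energy * dist x y`
(`sq_sub_le_energy_mul_dist`) extends functions of finite energy to the completion and lets
vanishing at the boundary survive passage to the closure. Uniqueness is the maximum principle
(`IsQHarmonic.nonpos`). Test functions exist because compactness and weak connectedness separate
clopen parts of the boundary by an open set with finite frontier in the graph
(`exists_isOpen_finite_frontier`). -/

/-! ### Absolutely continuous functions on an interval. -/

theorem AbsolutelyContinuousOnInterval.comp_lipschitzOnWith {f g : ℝ → ℝ} {a b : ℝ} {s : Set ℝ}
    {K : NNReal} (hg : LipschitzOnWith K g s) (hf : AbsolutelyContinuousOnInterval f a b)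
    (hs : MapsTo f (uIcc a b) s) : AbsolutelyContinuousOnInterval (fun t => g (f t)) a b := by
  refine squeeze_zero' (g := fun E => K * ∑ i ∈ Finset.range E.1, dist (f (E.2 i).1) (f (E.2 i).2))
    (Eventually.of_forall fun E => Finset.sum_nonneg fun i _ => dist_nonneg) ?_
    (by simpa using Tendsto.const_mul (K : ℝ) hf)
  filter_upwards [mem_inf_of_right (mem_principal_self _)] with E hE
  rw [Finset.mul_sum]
  exact Finset.sum_le_sum fun i hi =>
    hg.dist_le_mul _ (hs (hE.1 i hi).1) _ (hs (hE.1 i hi).2)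

/-- The fundamental theorem of calculus for absolutely continuous functions. -/
theorem AbsolutelyContinuousOnInterval.integral_eq_sub_of_ae {f f' : ℝ → ℝ} {a b : ℝ} (hab : a ≤ b)
    (hf : AbsolutelyContinuousOnInterval f a b)
    (h : ∀ᵐ t ∂volume.restrict (Ioo a b), HasDerivAt f (f' t) t) :
    IntervalIntegrable f' volume a b ∧ ∫ t in a..b, f' t = f b - f a := by
  have h1 : deriv f =ᵐ[volume.restrict (Ioc a b)] f' := by
    rw [← restrict_Ioo_eq_restrict_Ioc]
    filter_upwards [h] with t ht using ht.deriv
  constructor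
  · rw [intervalIntegrable_iff_integrableOn_Ioc_of_le hab]
    exact ((intervalIntegrable_iff_integrableOn_Ioc_of_le hab).1 hf.intervalIntegrable_deriv).congr
      h1
  · rw [← hf.integral_deriv_eq_sub, intervalIntegral.integral_of_le hab,
      intervalIntegral.integral_of_le hab]
    exact (integral_congr_ae h1).symm

/-- Since `q` is only integrable, the chain rule holds only almost everywhere. It still integrates,
because `exp` is Lipschitz on the bounded range of the primitive and so the composite is absolutely
continuous. -/
theorem intervalIntegral_exp_primitive {q : ℝ → ℝ} (hq : Integrable q) {t : ℝ} (ht : 0 ≤ t) :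
    IntervalIntegrable (fun s => q s * Real.exp (∫ r in 0..s, q r)) volume 0 t ∧
    ∫ s in 0..t, q s * Real.exp (∫ r in 0..s, q r) = Real.exp (∫ r in 0..t, q r) - 1 := by
  have hi : IntervalIntegrable q volume 0 t := hq.intervalIntegrable
  have hac := hi.absolutelyContinuousOnInterval_intervalIntegral (c := 0) (by simp)
  obtain ⟨C, hC⟩ := hac.exists_bound
  have hL : ∃ K, LipschitzOnWith K Real.exp (Icc (-C) C) :=
    (Real.contDiff_exp (n := 1)).contDiffOn.exists_lipschitzOnWith (by decide)
      (convex_Icc _ _) isCompact_Icc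
  obtain ⟨K, hK⟩ := hL
  have hac2 := AbsolutelyContinuousOnInterval.comp_lipschitzOnWith hK hac
    (fun s hs => abs_le.1 (hC s hs))
  have := hac2.integral_eq_sub_of_ae ht (f' := fun s => q s * Real.exp (∫ r in 0..s, q r)) ?_
  · simpa using this
  · rw [ae_restrict_iff' measurableSet_Ioo]
    filter_upwards [hi.ae_hasDerivAt_integral] with s hs hs2
    have hs3 : s ∈ uIcc 0 t := by rw [uIcc_of_le ht]; exact Ioo_subset_Icc_self hs2
    have := (hs hs3 0 (by simp)).exp
    rwa [mul_comm] at this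

/-! ### Picard iteration with an integrable coefficient. -/

/-- Successive approximations of the solution of `y'' = q y`, `y 0 = a`, `y' 0 = b`. -/
noncomputable def picardSeq (q : ℝ → ℝ) (a b : ℝ) : ℕ → ℝ → ℝ
  | 0 => fun _ => 0
  | n + 1 => fun t => a + ∫ s in 0..t, (b + ∫ r in 0..s, q r * picardSeq q a b n r)

section picard
variable {q : ℝ → ℝ} {a b : ℝ}

theorem continuous_picardSeq (hq : Integrable q) (n : ℕ) : Continuous (picardSeq q a b n) ∧
    ∀ s t, IntervalIntegrable (fun r => q r * picardSeq q a b n r) volume s t := by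
  have key : ∀ f : ℝ → ℝ, Continuous f →
      ∀ s t, IntervalIntegrable (fun r => q r * f r) volume s t := fun f hf s t =>
    hq.intervalIntegrable.mul_continuousOn hf.continuousOn
  have : Continuous (picardSeq q a b n) := by
    induction n with
    | zero => exact continuous_const
    | succ n ih =>
      have h1 : Continuous fun s => b + ∫ r in 0..s, q r * picardSeq q a b n r :=
        continuous_const.add (intervalIntegral.continuous_primitive (key _ ih) 0)
      exact continuous_const.add (intervalIntegral.continuous_primitive
        (fun s t => h1.intervalIntegrable s t) 0)
  exact ⟨this, key _ this⟩

theorem continuous_picardSeq_deriv (hq : Integrable q) (n : ℕ) :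
    Continuous fun s => b + ∫ r in 0..s, q r * picardSeq q a b n r :=
  continuous_const.add (intervalIntegral.continuous_primitive (continuous_picardSeq hq n).2 0)

/-- Nonnegative data make the iteration, started at `0`, increase. Convergence then needs only an
upper bound, with no contraction estimate. -/
theorem picardSeq_mono (hq : Integrable q) (hq0 : ∀ t, 0 ≤ q t) (ha : 0 ≤ a) (hb : 0 ≤ b) (n : ℕ)
    {t : ℝ} (ht : 0 ≤ t) :
    0 ≤ picardSeq q a b n t ∧ picardSeq q a b n t ≤ picardSeq q a b (n + 1) t := by
  induction n generalizing t with
  | zero =>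
    refine ⟨le_rfl, ?_⟩
    simp only [picardSeq, mul_zero, intervalIntegral.integral_zero, add_zero,
      intervalIntegral.integral_const, smul_eq_mul, sub_zero]
    positivity
  | succ n ih =>
    refine ⟨(ih ht).1.trans (ih ht).2, ?_⟩
    have h1 : ∀ s, 0 ≤ s → ∫ r in 0..s, q r * picardSeq q a b n r ≤
        ∫ r in 0..s, q r * picardSeq q a b (n + 1) r := fun s hs =>
      intervalIntegral.integral_mono_on hs ((continuous_picardSeq hq n).2 0 s)
        ((continuous_picardSeq hq (n + 1)).2 0 s)
        fun r hr => mul_le_mul_of_nonneg_left (ih hr.1).2 (hq0 r)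
    have h2 := intervalIntegral.integral_mono_on ht
      ((continuous_picardSeq_deriv (a := a) (b := b) hq n).intervalIntegrable (μ := volume) 0 t)
      ((continuous_picardSeq_deriv (a := a) (b := b) hq (n + 1)).intervalIntegrable (μ := volume) 0 t)
      fun s hs => add_le_add_right (h1 s hs.1) b
    exact add_le_add_right h2 a

/-- A Gronwall bound: the exponential of `∫ (1 + q)` is a supersolution both for the iterate and for
its derivative. The `1` is cut off to `(0, ℓ]` to stay integrable on the line. -/
theorem picardSeq_le (hq : Integrable q) (hq0 : ∀ t, 0 ≤ q t) (ha : 0 ≤ a) (hb : 0 ≤ b)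
    {ℓ : ℝ} (n : ℕ) {t : ℝ} (ht : t ∈ Icc 0 ℓ) : 
    picardSeq q a b n t ≤ (a + b) * Real.exp (∫ r in 0..t, ((Ioc 0 ℓ).indicator 1 r + q r)) := by
  set p : ℝ → ℝ := fun r => (Ioc 0 ℓ).indicator 1 r + q r with hp
  have hpi : Integrable p := by
    refine Integrable.add ?_ hq
    rw [integrable_indicator_iff measurableSet_Ioc]
    exact integrableOn_const (by simp)
  have hE : Continuous fun t => Real.exp (∫ r in 0..t, p r) :=
    Real.continuous_exp.comp (intervalIntegral.continuous_primitive
      (fun _ _ => hpi.intervalIntegrable) 0)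
  have hp1 : ∀ r ∈ Ioc 0 ℓ, p r = 1 + q r := fun r hr => by simp [hp, hr]
  have hE1 : ∀ t, 0 ≤ t → 1 ≤ Real.exp (∫ r in 0..t, p r) := fun t ht => by
    rw [Real.one_le_exp_iff]
    refine intervalIntegral.integral_nonneg ht fun r _ => add_nonneg ?_ (hq0 r)
    exact indicator_nonneg (fun _ _ => zero_le_one) _
  -- Used with `g = q` to bound the derivative of the next iterate, then with `g = 1` to bound the
  -- iterate itself.
  have hfin : ∀ g : ℝ → ℝ, (∀ r ∈ Ioc 0 ℓ, g r ≤ p r) → ∀ t ∈ Icc 0 ℓ,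
      IntervalIntegrable (fun r => g r * ((a + b) * Real.exp (∫ r in 0..r, p r))) volume 0 t → 
      ∫ r in 0..t, g r * ((a + b) * Real.exp (∫ r in 0..r, p r)) ≤
        (a + b) * (Real.exp (∫ r in 0..t, p r) - 1) := by
    intro g hg t ht hgi
    obtain ⟨h1, h2⟩ := intervalIntegral_exp_primitive hpi ht.1
    rw [← h2, ← intervalIntegral.integral_const_mul]
    refine intervalIntegral.integral_mono_on_of_le_Ioo ht.1 hgi (h1.const_mul _) fun r hr => ?_
    have := mul_le_mul_of_nonneg_right (hg r ⟨hr.1, hr.2.le.trans ht.2⟩)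
      (mul_nonneg (add_nonneg ha hb) (Real.exp_nonneg (∫ r in 0..r, p r)))
    linarith
  induction n generalizing t with
  | zero => exact mul_nonneg (add_nonneg ha hb) (Real.exp_nonneg _)
  | succ n ih =>
    have h1 : ∀ s ∈ Icc 0 ℓ, b + ∫ r in 0..s, q r * picardSeq q a b n r ≤
        (a + b) * Real.exp (∫ r in 0..s, p r) := by
      intro s hs
      have hi : IntervalIntegrable (fun r => q r * ((a + b) * Real.exp (∫ r in 0..r, p r)))
          volume 0 s := hq.intervalIntegrable.mul_continuousOn (hE.const_mul _).continuousOn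
      have h3 := intervalIntegral.integral_mono_on hs.1 ((continuous_picardSeq hq n).2 0 s) hi
        fun r hr => mul_le_mul_of_nonneg_left (ih ⟨hr.1, hr.2.trans hs.2⟩) (hq0 r)
      have h4 := hfin q (fun r hr => by rw [hp1 r hr]; linarith) s hs hi
      nlinarith [hE1 s hs.1]
    have h2 := intervalIntegral.integral_mono_on ht.1
      ((continuous_picardSeq_deriv (a := a) (b := b) hq n).intervalIntegrable (μ := volume) 0 t)
      ((hE.const_mul _).intervalIntegrable (μ := volume) 0 t) fun s hs => h1 s ⟨hs.1, hs.2.trans ht.2⟩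
    have h5 := hfin (fun _ => 1) (fun r hr => by rw [hp1 r hr]; linarith [hq0 r]) t ht
      (by simpa using (hE.const_mul (a + b)).intervalIntegrable (μ := volume) 0 t)
    simp only [one_mul] at h5
    simp only [picardSeq]
    nlinarith [hE1 t ht.1]

end picard

/-! ### Solutions on one interval: Green's formula, energy, maximum principle. -/

/-- `u` solves `u'' = q u` on `[0, ℓ]` with absolutely continuous derivative `w`. -/
structure IsSol (ℓ : ℝ) (q u w : ℝ → ℝ) : Prop where
  ac : AbsolutelyContinuousOnInterval w 0 ℓ
  deriv : ∀ t ∈ Icc 0 ℓ, HasDerivWithinAt u (w t) (Icc 0 ℓ) t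
  eqn : ∀ᵐ t ∂(volume.restrict (Ioo 0 ℓ)), HasDerivAt w (q t * u t) t

namespace IsSol
variable {ℓ : ℝ} {q u w v z : ℝ → ℝ}

theorem const_mul (c : ℝ) (h : IsSol ℓ q u w) : IsSol ℓ q (fun t => c * u t) (fun t => c * w t) where
  ac := h.ac.const_mul c
  deriv t ht := (h.deriv t ht).const_mul c
  eqn := h.eqn.mono fun t ht => by simpa [mul_left_comm] using ht.const_mul c

theorem add (h : IsSol ℓ q u w) (h' : IsSol ℓ q v z) :
    IsSol ℓ q (fun t => u t + v t) (fun t => w t + z t) where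
  ac := h.ac.fun_add h'.ac
  deriv t ht := (h.deriv t ht).add (h'.deriv t ht)
  eqn := by
    filter_upwards [h.eqn, h'.eqn] with t h1 h2
    rw [mul_add]
    exact h1.add h2

theorem congr (h : IsSol ℓ q u w) (huv : EqOn v u (Icc 0 ℓ)) : IsSol ℓ q v w where
  ac := h.ac
  deriv t ht := (h.deriv t ht).congr huv (huv ht)
  eqn := by
    have := h.eqn
    rw [ae_restrict_iff' measurableSet_Ioo] at this ⊢
    filter_upwards [this] with t h1 h2
    rw [huv (Ioo_subset_Icc_self h2)]
    exact h1 h2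

theorem congr_coeff {p : ℝ → ℝ} (h : IsSol ℓ q u w) (hp : EqOn p q (Ioo 0 ℓ)) :
    IsSol ℓ p u w where
  ac := h.ac
  deriv := h.deriv
  eqn := by
    have := h.eqn
    rw [ae_restrict_iff' measurableSet_Ioo] at this ⊢
    filter_upwards [this] with t h1 h2
    rw [hp h2]
    exact h1 h2

theorem hasDerivAt (h : IsSol ℓ q u w) {t : ℝ} (ht : t ∈ Ioo 0 ℓ) : HasDerivAt u (w t) t :=
  (h.deriv t (Ioo_subset_Icc_self ht)).hasDerivAt (Icc_mem_nhds ht.1 ht.2)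

theorem continuousOn (h : IsSol ℓ q u w) : ContinuousOn u (Icc 0 ℓ) :=
  fun t ht => (h.deriv t ht).continuousWithinAt

theorem exists_bound (h : IsSol ℓ q u w) (hℓ : 0 ≤ ℓ) : ∃ K : NNReal, ∀ t ∈ Icc 0 ℓ, |w t| ≤ K := by
  obtain ⟨C, hC⟩ := h.ac.exists_bound
  rw [uIcc_of_le hℓ] at hC
  exact ⟨⟨max C 0, le_max_right _ _⟩, fun t ht => (hC t ht).trans (le_max_left _ _)⟩

theorem ac_self (h : IsSol ℓ q u w) (hℓ : 0 ≤ ℓ) : AbsolutelyContinuousOnInterval u 0 ℓ := by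
  obtain ⟨K, hK⟩ := h.exists_bound hℓ
  have : LipschitzOnWith K u (uIcc 0 ℓ) := by
    rw [uIcc_of_le hℓ]
    refine (convex_Icc 0 ℓ).lipschitzOnWith_of_nnnorm_hasDerivWithin_le h.deriv fun t ht => ?_
    exact hK t ht
  exact this.absolutelyContinuousOnInterval

/-- Green's formula. -/
theorem green (h : IsSol ℓ q u w) (hℓ : 0 ≤ ℓ) (hv : AbsolutelyContinuousOnInterval v 0 ℓ)
    (hz : ∀ᵐ t ∂(volume.restrict (Ioo 0 ℓ)), HasDerivAt v (z t) t) :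
    IntervalIntegrable (fun t => q t * u t * v t + w t * z t) volume 0 ℓ ∧
    ∫ t in 0..ℓ, (q t * u t * v t + w t * z t) = w ℓ * v ℓ - w 0 * v 0 := by
  refine (h.ac.fun_mul hv).integral_eq_sub_of_ae hℓ ?_
  filter_upwards [h.eqn, hz] with t h1 h2 using h1.mul h2

theorem ae_hasDerivAt (h : IsSol ℓ q u w) :
    ∀ᵐ t ∂(volume.restrict (Ioo 0 ℓ)), HasDerivAt u (w t) t := by
  rw [ae_restrict_iff' measurableSet_Ioo]
  exact Eventually.of_forall fun t ht => h.hasDerivAt ht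

/-- Both boundary terms equal `∫ (q u v + u' v')`, which is symmetric in the two solutions. -/
theorem green_symm (h : IsSol ℓ q u w) (h' : IsSol ℓ q v z) (hℓ : 0 ≤ ℓ) :
    w ℓ * v ℓ - w 0 * v 0 = z ℓ * u ℓ - z 0 * u 0 := by
  rw [← (h.green hℓ (h'.ac_self hℓ) h'.ae_hasDerivAt).2,
    ← (h'.green hℓ (h.ac_self hℓ) h.ae_hasDerivAt).2]
  exact intervalIntegral.integral_congr fun t _ => by ring

theorem intervalIntegrable_sq (h : IsSol ℓ q u w) :
    IntervalIntegrable (fun t => w t ^ 2) volume 0 ℓ := by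
  refine (ContinuousOn.pow ?_ 2).intervalIntegrable
  exact h.ac.continuousOn

/-- The boundary term is the whole energy `∫ (u'² + q u²)`; dropping the potential part leaves the
Dirichlet integral that the Hölder estimate needs. -/
theorem integral_sq_le (h : IsSol ℓ q u w) (hℓ : 0 ≤ ℓ) (hq : ∀ t ∈ Ioo 0 ℓ, 0 ≤ q t) :
    ∫ t in 0..ℓ, w t ^ 2 ≤ w ℓ * u ℓ - w 0 * u 0 := by
  have h1 := h.green hℓ (h.ac_self hℓ) h.ae_hasDerivAt
  rw [← h1.2]
  refine intervalIntegral.integral_mono_on_of_le_Ioo hℓ h.intervalIntegrable_sq h1.1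
    fun t ht => ?_
  nlinarith [hq t ht, mul_nonneg (hq t ht) (mul_self_nonneg (u t))]

theorem energy_nonneg (h : IsSol ℓ q u w) (hℓ : 0 ≤ ℓ) (hq : ∀ t ∈ Ioo 0 ℓ, 0 ≤ q t) :
    0 ≤ w ℓ * u ℓ - w 0 * u 0 :=
  (intervalIntegral.integral_nonneg hℓ fun _ _ => sq_nonneg _).trans (h.integral_sq_le hℓ hq)

/-- The energy of the solution is at most that of a constant function with the same boundary
values. -/
theorem energy_le (h : IsSol ℓ q u w) (hℓ : 0 ≤ ℓ) (hq : ∀ t ∈ Ioo 0 ℓ, 0 ≤ q t)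
    (hqi : IntervalIntegrable q volume 0 ℓ) {a : ℝ} (h0 : u 0 = a) (h1 : u ℓ = a) :
    w ℓ * u ℓ - w 0 * u 0 ≤ a ^ 2 * ∫ t in 0..ℓ, q t := by
  have e1 := h.green hℓ (h.ac_self hℓ) h.ae_hasDerivAt
  have e2 := h.green (v := fun _ => a) (z := fun _ => 0) hℓ
    (contDiffOn_const.absolutelyContinuousOnInterval)
    (Eventually.of_forall fun t => hasDerivAt_const _ _)
  -- With equal endpoint values both Green identities have the same boundary term `E`, so
  -- integrating `q (u - a)² + w² ≥ 0` gives `2E ≤ E + a² ∫ q`.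
  have e3 : ∫ t in 0..ℓ, (2 * (q t * u t * a + w t * 0)) ≤
      ∫ t in 0..ℓ, ((q t * u t * u t + w t * w t) + a ^ 2 * q t) := by
    refine intervalIntegral.integral_mono_on_of_le_Ioo hℓ (e2.1.const_mul 2)
      (e1.1.add (hqi.const_mul _)) fun t ht => ?_
    nlinarith [mul_nonneg (hq t ht) (sq_nonneg (u t - a)), mul_self_nonneg (w t)]
  rw [intervalIntegral.integral_const_mul, intervalIntegral.integral_add e1.1 (hqi.const_mul _),
    intervalIntegral.integral_const_mul, e1.2, e2.2] at e3
  rw [h0, h1] at *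
  linarith

theorem deriv_le_of_nonneg (h : IsSol ℓ q u w) (hq : ∀ t ∈ Ioo 0 ℓ, 0 ≤ q t) {a b : ℝ}
    (ha : 0 ≤ a) (hab : a ≤ b) (hb : b ≤ ℓ) (hu : ∀ t ∈ Icc a b, 0 ≤ u t) : w a ≤ w b := by
  have hsub : Icc a b ⊆ Icc 0 ℓ := Icc_subset_Icc ha hb
  have h1 : AbsolutelyContinuousOnInterval w a b := h.ac.mono (by
    rwa [uIcc_of_le hab, uIcc_of_le (ha.trans (hab.trans hb))])
  have h2 := h1.integral_eq_sub_of_ae hab (f' := fun t => q t * u t)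
    (ae_restrict_of_ae_restrict_of_subset (Ioo_subset_Ioo ha hb) h.eqn)
  have h3 : 0 ≤ ∫ t in a..b, q t * u t := by
    rw [← intervalIntegral.integral_zero (a := a) (b := b)]
    refine intervalIntegral.integral_mono_on_of_le_Ioo hab (by simp) h2.1 fun t ht => ?_
    exact mul_nonneg (hq t (Ioo_subset_Ioo ha hb ht)) (hu t (Ioo_subset_Icc_self ht))
  linarith [h2.2]

/-- The strong maximum principle on an interval. -/
theorem eq_of_max (h : IsSol ℓ q u w) (hq : ∀ t ∈ Ioo 0 ℓ, 0 ≤ q t) {M : ℝ} (hM : 0 < M)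
    (hu : ∀ t ∈ Icc 0 ℓ, u t ≤ M) {t₀ : ℝ} (ht₀ : t₀ ∈ Icc 0 ℓ) (h0 : u t₀ = M) (h1 : w t₀ = 0) :
    ∀ t ∈ Icc 0 ℓ, u t = M := by
  have hℓ : 0 ≤ ℓ := ht₀.1.trans ht₀.2
  have hw : ContinuousOn w (Icc 0 ℓ) := by
    have := h.ac.continuousOn
    rwa [uIcc_of_le hℓ] at this
  -- Connectedness argument: the set where `u` touches `M` with zero derivative is clopen in the
  -- interval.
  set Z : Set (Icc (0 : ℝ) ℓ) := {t | u t = M ∧ w t = 0} with hZ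
  have hclosed : IsClosed Z := by
    refine IsClosed.inter ?_ ?_
    · exact isClosed_eq h.continuousOn.domRestrict continuous_const
    · exact isClosed_eq hw.domRestrict continuous_const
  have hopen : IsOpen Z := by
    rw [isOpen_iff_mem_nhds]
    rintro ⟨t, ht⟩ ⟨hut, hwt⟩
    simp only at hut hwt
    have hpos : ∀ᶠ s in 𝓝[Icc 0 ℓ] t, 0 < u s :=
      (h.continuousOn t ht).eventually (lt_mem_nhds (by rw [hut]; exact hM))
    obtain ⟨δ, hδ, hball⟩ := Metric.mem_nhdsWithin_iff.1 hpos
    have hpos' : ∀ s ∈ Icc 0 ℓ, |s - t| < δ → 0 < u s := fun s hs hst =>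
      hball ⟨by rwa [Metric.mem_ball, Real.dist_eq], hs⟩
    -- Near `t` the solution is positive, so `w` is monotone there and vanishes at `t`. Hence `u`
    -- does not decrease away from `t` on either side, and the maximum forces it to be constant.
    have heq : ∀ s ∈ Icc 0 ℓ, |s - t| < δ → u s = M := by
      intro s hs hst
      refine le_antisymm (hu s hs) ?_
      rcases le_total t s with hts | hts
      · rw [abs_of_nonneg (by linarith)] at hst
        have hmono : MonotoneOn u (Icc t s) := by
          refine monotoneOn_of_hasDerivWithinAt_nonneg (f' := w) (convex_Icc _ _)
            (h.continuousOn.mono (Icc_subset_Icc ht.1 hs.2)) ?_ ?_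
          · intro r hr
            rw [interior_Icc] at hr ⊢
            exact (h.hasDerivAt (Ioo_subset_Ioo ht.1 hs.2 hr)).hasDerivWithinAt
          · intro r hr
            rw [interior_Icc] at hr
            rw [← hwt]
            refine h.deriv_le_of_nonneg hq ht.1 hr.1.le (hr.2.le.trans hs.2) fun x hx => ?_
            refine (hpos' x ⟨ht.1.trans hx.1, hx.2.trans (hr.2.le.trans hs.2)⟩ ?_).le
            rw [abs_of_nonneg (by linarith [hx.1])]
            linarith [hx.2, hr.2]
        rw [← hut]
        exact hmono ⟨le_rfl, hts⟩ ⟨hts, le_rfl⟩ hts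
      · rw [abs_of_nonpos (by linarith)] at hst
        have hmono : AntitoneOn u (Icc s t) := by
          refine antitoneOn_of_hasDerivWithinAt_nonpos (f' := w) (convex_Icc _ _)
            (h.continuousOn.mono (Icc_subset_Icc hs.1 ht.2)) ?_ ?_
          · intro r hr
            rw [interior_Icc] at hr ⊢
            exact (h.hasDerivAt (Ioo_subset_Ioo hs.1 ht.2 hr)).hasDerivWithinAt
          · intro r hr
            rw [interior_Icc] at hr
            rw [← hwt]
            refine h.deriv_le_of_nonneg hq (hs.1.trans hr.1.le) hr.2.le ht.2 fun x hx => ?_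
            refine (hpos' x ⟨(hs.1.trans hr.1.le).trans hx.1, hx.2.trans ht.2⟩ ?_).le
            rw [abs_of_nonpos (by linarith [hx.2])]
            linarith [hx.1, hr.1]
        rw [← hut]
        exact hmono ⟨le_rfl, hts⟩ ⟨hts, le_rfl⟩ hts
    refine Metric.mem_nhds_iff.2 ⟨δ, hδ, ?_⟩
    rintro ⟨s, hs⟩ hst
    rw [Metric.mem_ball, Subtype.dist_eq, Real.dist_eq] at hst
    refine ⟨heq s hs hst, ?_⟩
    -- Derivatives within a one-point interval are not unique, so that case is treated apart.
    rcases eq_or_lt_of_le hℓ with rfl | hℓ'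
    · have : s = t := by rw [Icc_self, mem_singleton_iff] at hs ht; rw [hs, ht]
      simp only [this, hwt]
    · have hd := h.deriv s hs
      have hc : HasDerivWithinAt u 0 (Icc 0 ℓ) s := by
        refine (hasDerivWithinAt_const s (Icc 0 ℓ) M).congr_of_eventuallyEq ?_ (heq s hs hst)
        have : ∀ᶠ x in 𝓝[Icc 0 ℓ] s, |x - t| < δ := by
          refine mem_nhdsWithin_of_mem_nhds ?_
          exact (continuous_abs.comp (continuous_id.sub continuous_const)).continuousAt.eventually
            (gt_mem_nhds hst)
        filter_upwards [this, self_mem_nhdsWithin] with x hx hx2 using heq x hx2 hx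
      exact (uniqueDiffOn_Icc hℓ' s hs).eq_deriv _ hd hc
  have : PreconnectedSpace (Icc (0 : ℝ) ℓ) := Subtype.preconnectedSpace isPreconnected_Icc
  have huniv := IsClopen.eq_univ ⟨hclosed, hopen⟩ ⟨⟨t₀, ht₀⟩, h0, h1⟩
  intro t ht
  have : (⟨t, ht⟩ : Icc (0 : ℝ) ℓ) ∈ Z := huniv ▸ mem_univ _
  exact this.1

end IsSol

/-! ### Initial and boundary value problems on an edge. -/

/-- The initial value problem `u'' = q u`, `u 0 = a`, `u' 0 = b`. -/
theorem exists_isSol_ivp {q : ℝ → ℝ} (hq : Integrable q) (hq0 : ∀ t, 0 ≤ q t) {a b ℓ : ℝ}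
    (ha : 0 ≤ a) (hb : 0 ≤ b) (hℓ : 0 < ℓ) :
    ∃ u w, IsSol ℓ q u w ∧ u 0 = a ∧ w 0 = b ∧ a + b * ℓ ≤ u ℓ := by
  set B : ℝ → ℝ := fun t =>
    (a + b) * Real.exp (∫ r in 0..t, ((Ioc 0 ℓ).indicator 1 r + q r)) with hB
  have hBc : Continuous B := by
    refine continuous_const.mul (Real.continuous_exp.comp
      (intervalIntegral.continuous_primitive (fun s t => ?_) 0))
    refine (Integrable.add ?_ hq).intervalIntegrable
    rw [integrable_indicator_iff measurableSet_Ioc]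
    exact integrableOn_const (by simp)
  set p := picardSeq q a b with hp
  have hp0 : ∀ n, ∀ t ∈ Icc 0 ℓ, 0 ≤ p n t := fun n t ht =>
    (picardSeq_mono hq hq0 ha hb n ht.1).1
  have hpB : ∀ n, ∀ t ∈ Icc 0 ℓ, p n t ≤ B t := fun n t ht => picardSeq_le hq hq0 ha hb n ht
  set y : ℝ → ℝ := fun t => ⨆ n, p n t with hy
  have hlim : ∀ t ∈ Icc 0 ℓ, Tendsto (fun n => p n t) atTop (𝓝 (y t)) := fun t ht =>
    tendsto_atTop_ciSup (monotone_nat_of_le_succ fun n => (picardSeq_mono hq hq0 ha hb n ht.1).2)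
      ⟨B t, by rintro _ ⟨n, rfl⟩; exact hpB n t ht⟩
  have hy0 : ∀ t ∈ Icc 0 ℓ, 0 ≤ y t := fun t ht =>
    ge_of_tendsto' (hlim t ht) fun n => hp0 n t ht
  have hqB : ∀ s t, IntervalIntegrable (fun r => q r * B r) volume s t := fun s t =>
    hq.intervalIntegrable.mul_continuousOn hBc.continuousOn
  have hlimW : ∀ t ∈ Icc 0 ℓ, Tendsto (fun n => b + ∫ r in 0..t, q r * p n r) atTop
      (𝓝 (b + ∫ r in 0..t, q r * y r)) := by
    intro t ht
    have hsub : uIoc 0 t ⊆ Icc 0 ℓ := by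
      rw [uIoc_of_le ht.1]
      exact fun r hr => ⟨hr.1.le, hr.2.trans ht.2⟩
    refine tendsto_const_nhds.add
      (intervalIntegral.tendsto_integral_filter_of_dominated_convergence (fun r => q r * B r)
        (Eventually.of_forall fun n => ?_) (Eventually.of_forall fun n => ?_) (hqB 0 t) ?_)
    · rw [uIoc_of_le ht.1]
      exact ((continuous_picardSeq hq n).2 0 t).1.aestronglyMeasurable
    · refine Eventually.of_forall fun r hr => ?_
      rw [Real.norm_eq_abs, abs_of_nonneg (mul_nonneg (hq0 r) (hp0 n r (hsub hr)))]
      exact mul_le_mul_of_nonneg_left (hpB n r (hsub hr)) (hq0 r)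
    · exact Eventually.of_forall fun r hr => (hlim r (hsub hr)).const_mul _
  have hqy : IntegrableOn (fun r => q r * y r) (Ioc 0 ℓ) := by
    refine Integrable.mono' (hqB 0 ℓ).1 ?_ ?_
    · refine aestronglyMeasurable_of_tendsto_ae atTop (f := fun n r => q r * p n r)
        (fun n => ((continuous_picardSeq hq n).2 0 ℓ).1.aestronglyMeasurable) ?_
      rw [ae_restrict_iff' measurableSet_Ioc]
      exact Eventually.of_forall fun r hr => (hlim r (Ioc_subset_Icc_self hr)).const_mul _
    · rw [ae_restrict_iff' measurableSet_Ioc]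
      refine Eventually.of_forall fun r hr => ?_
      have hr' := Ioc_subset_Icc_self hr
      rw [Real.norm_eq_abs, abs_of_nonneg (mul_nonneg (hq0 r) (hy0 r hr'))]
      exact mul_le_mul_of_nonneg_left (le_of_tendsto' (hlim r hr') fun n => hpB n r hr') (hq0 r)
  -- The limit `y` is controlled only on `[0, ℓ]`; the cutoff makes `w` continuous on the whole
  -- line, so that its primitive is differentiable at the endpoints too.
  set g := (Ioc 0 ℓ).indicator (fun r => q r * y r) with hg
  have hgi : Integrable g := (integrable_indicator_iff measurableSet_Ioc).2 hqy
  set w : ℝ → ℝ := fun t => b + ∫ r in 0..t, g r with hw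
  have hwc : Continuous w := continuous_const.add
    (intervalIntegral.continuous_primitive (fun _ _ => hgi.intervalIntegrable) 0)
  have hgw : ∀ t ∈ Icc 0 ℓ, w t = b + ∫ r in 0..t, q r * y r := by
    intro t ht
    simp only [hw]
    congr 1
    refine intervalIntegral.integral_congr_ae (Eventually.of_forall fun r hr => ?_)
    rw [uIoc_of_le ht.1] at hr
    exact indicator_of_mem (show r ∈ Ioc 0 ℓ from ⟨hr.1, hr.2.trans ht.2⟩) _
  have hwb : ∀ t ∈ Icc 0 ℓ, b ≤ w t := by
    intro t ht
    have : 0 ≤ ∫ r in 0..t, g r := intervalIntegral.integral_nonneg_of_forall ht.1 fun r =>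
      indicator_nonneg (fun r hr => mul_nonneg (hq0 r) (hy0 r (Ioc_subset_Icc_self hr))) r
    simp only [hw]
    linarith
  have hyu : ∀ t ∈ Icc 0 ℓ, y t = a + ∫ r in 0..t, w r := by
    intro t ht
    have hsub : uIoc 0 t ⊆ Icc 0 ℓ := by
      rw [uIoc_of_le ht.1]
      exact fun r hr => ⟨hr.1.le, hr.2.trans ht.2⟩
    refine tendsto_nhds_unique ((hlim t ht).comp (tendsto_add_atTop_nat 1)) ?_
    refine tendsto_const_nhds.add
      (intervalIntegral.tendsto_integral_filter_of_dominated_convergence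
        (fun r => w r) (Eventually.of_forall fun n => ?_)
        (Eventually.of_forall fun n => ?_) (hwc.intervalIntegrable 0 t) ?_)
    · exact (continuous_picardSeq_deriv hq n).aestronglyMeasurable
    · refine Eventually.of_forall fun s hs => ?_
      have hs' := hsub hs
      have hle : ∀ r ∈ Icc 0 s, 0 ≤ q r * p n r := fun r hr =>
        mul_nonneg (hq0 r) (hp0 n r ⟨hr.1, hr.2.trans hs'.2⟩)
      rw [Real.norm_eq_abs, abs_of_nonneg
        (add_nonneg hb (intervalIntegral.integral_nonneg hs'.1 hle)), hgw s hs']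
      refine add_le_add_right (intervalIntegral.integral_mono_on_of_le_Ioo hs'.1
        ((continuous_picardSeq hq n).2 0 s) ?_ fun r hr => ?_) b
      · rw [intervalIntegrable_iff_integrableOn_Ioc_of_le hs'.1]
        exact hqy.mono_set (Ioc_subset_Ioc_right hs'.2)
      · have hr' : r ∈ Icc 0 ℓ := ⟨hr.1.le, hr.2.le.trans hs'.2⟩
        exact mul_le_mul_of_nonneg_left ((monotone_nat_of_le_succ fun n =>
          (picardSeq_mono hq hq0 ha hb n hr'.1).2).ge_of_tendsto (hlim r hr') n) (hq0 r)
    · refine Eventually.of_forall fun s hs => ?_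
      rw [hgw s (hsub hs)]
      exact hlimW s (hsub hs)
  refine ⟨fun t => a + ∫ r in 0..t, w r, w, ⟨?_, ?_, ?_⟩, by simp, by simp [hw], ?_⟩
  · exact (contDiffOn_const.absolutelyContinuousOnInterval).fun_add
      (hgi.intervalIntegrable.absolutelyContinuousOnInterval_intervalIntegral (by simp))
  · intro t _
    exact ((hwc.integral_hasStrictDerivAt 0 t).hasDerivAt.const_add a).hasDerivWithinAt
  · rw [ae_restrict_iff' measurableSet_Ioo]
    have := hgi.intervalIntegrable (a := 0) (b := ℓ)
    filter_upwards [this.ae_hasDerivAt_integral] with t ht ht'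
    have h1 := (ht (by rw [uIcc_of_le hℓ.le]; exact Ioo_subset_Icc_self ht') 0 (by simp)).const_add b
    rwa [hg, indicator_of_mem (Ioo_subset_Ioc_self ht'), hyu t (Ioo_subset_Icc_self ht')] at h1
  · have := intervalIntegral.integral_mono_on hℓ.le (intervalIntegrable_const (c := b))
      (hwc.intervalIntegrable (μ := volume) 0 ℓ) hwb
    simp only [intervalIntegral.integral_const, sub_zero, smul_eq_mul] at this
    linarith

/-- The boundary value problem `u'' = q u`, `u 0 = A`, `u ℓ = B`. -/
theorem exists_isSol_bvp {q : ℝ → ℝ} {ℓ : ℝ} (hℓ : 0 < ℓ) (hq : IntegrableOn q (Ioo 0 ℓ))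
    (hq0 : ∀ t ∈ Ioo 0 ℓ, 0 ≤ q t) (A B : ℝ) :
    ∃ u w, IsSol ℓ q u w ∧ u 0 = A ∧ u ℓ = B := by
  have hp : Integrable ((Ioo 0 ℓ).indicator q) := (integrable_indicator_iff measurableSet_Ioo).2 hq
  have hp0 : ∀ t, 0 ≤ (Ioo 0 ℓ).indicator q t := indicator_nonneg hq0
  have heq : EqOn q ((Ioo 0 ℓ).indicator q) (Ioo 0 ℓ) := fun t ht => (indicator_of_mem ht q).symm
  obtain ⟨u, w, h, h0, -, -⟩ := exists_isSol_ivp hp hp0 zero_le_one le_rfl hℓ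
  obtain ⟨v, z, h', h0', -, hle⟩ := exists_isSol_ivp hp hp0 le_rfl zero_le_one hℓ
  -- Shooting works because the solution with `v 0 = 0`, `v' 0 = 1` satisfies `v ℓ ≥ ℓ`.
  have hv : v ℓ ≠ 0 := by linarith
  refine ⟨_, _, ((h.const_mul A).add (h'.const_mul ((B - A * u ℓ) / v ℓ))).congr_coeff heq, ?_, ?_⟩
  · simp [h0, h0']
  · field_simp
    ring

/-- A basis of the solutions of `u'' = q u`, with the Dirichlet-Neumann form of the interval
written as a sum of two squares. -/
theorem exists_isSol_basis {q : ℝ → ℝ} {ℓ : ℝ} (hℓ : 0 < ℓ) (hq : IntegrableOn q (Ioo 0 ℓ))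
    (hq0 : ∀ t ∈ Ioo 0 ℓ, 0 ≤ q t) :
    ∃ (α α' β β' : ℝ → ℝ) (x y z : ℝ), IsSol ℓ q α α' ∧ IsSol ℓ q β β' ∧
      α 0 = 1 ∧ α ℓ = 0 ∧ β 0 = 0 ∧ β ℓ = 1 ∧
      -α' 0 = x * x ∧ -β' 0 = x * y ∧ α' ℓ = x * y ∧ β' ℓ = y * y + z * z := by
  obtain ⟨α, α', hα, hα0, hα1⟩ := exists_isSol_bvp hℓ hq hq0 1 0
  obtain ⟨β, β', hβ, hβ0, hβ1⟩ := exists_isSol_bvp hℓ hq hq0 0 1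
  have hs := hα.green_symm hβ hℓ.le
  simp only [hα0, hα1, hβ0, hβ1, mul_one, mul_zero, sub_zero, zero_sub] at hs
  -- The value of the quadratic form at `(s, t)` is the energy of `s α + t β`.
  have hpsd : ∀ s t : ℝ, 0 ≤ -α' 0 * s ^ 2 + 2 * α' ℓ * (s * t) + β' ℓ * t ^ 2 := by
    intro s t
    have := ((hα.const_mul s).add (hβ.const_mul t)).energy_nonneg hℓ.le hq0
    simp only [hα0, hα1, hβ0, hβ1] at this
    have e : β' 0 = -α' ℓ := by linarith
    rw [e] at this
    nlinarith
  -- `-α' 0` is the energy of `α`. If it were zero, `α` would be constant, against `α 0 = 1` and `α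
  -- ℓ = 0`.
  have hp : 0 < -α' 0 := by
    have h1 : 0 ≤ -α' 0 := by simpa using hpsd 1 0
    refine lt_of_le_of_ne h1 fun h2 => ?_
    have h3 := hα.eq_of_max (M := 1) (t₀ := 0) hq0 one_pos ?_ ⟨le_rfl, hℓ.le⟩ hα0 (by linarith)
    · have := h3 ℓ ⟨hℓ.le, le_rfl⟩
      rw [hα1] at this
      exact zero_ne_one this
    · have h4 := hα.integral_sq_le hℓ.le hq0
      rw [hα0, hα1] at h4
      have h5 : ∀ t ∈ Icc 0 ℓ, α' t = 0 := by
        intro t ht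
        by_contra hne
        have : 0 < ∫ t in 0..ℓ, α' t ^ 2 := by
          refine intervalIntegral.integral_pos hℓ ?_ (fun _ _ => sq_nonneg _) ⟨t, ht, by positivity⟩
          have := hα.ac.continuousOn
          rw [uIcc_of_le hℓ.le] at this
          exact this.pow 2
        linarith
      intro t ht
      have h6 : α 0 = α t := by
        refine (convex_Icc 0 ℓ).is_const_of_fderivWithin_eq_zero (𝕜 := ℝ)
          (fun s hs => (hα.deriv s hs).differentiableWithinAt) (fun s hs => ?_)
          ⟨le_rfl, hℓ.le⟩ ht
        have := (hα.deriv s hs).hasFDerivWithinAt.fderivWithin (uniqueDiffOn_Icc hℓ s hs)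
        rw [this, h5 s hs]
        ext
        simp
      exact (h6.symm.trans hα0).le
  -- Cholesky factorization of the 2 by 2 form; `z²` is the Schur complement, nonnegative because it
  -- is the minimum of the form over `s` at `t = 1`.
  set x := Real.sqrt (-α' 0) with hx
  have hxx : x * x = -α' 0 := Real.mul_self_sqrt hp.le
  have hx0 : 0 < x := Real.sqrt_pos.2 hp
  have hy : x * (α' ℓ / x) = α' ℓ := by field_simp
  have hz : 0 ≤ β' ℓ - (α' ℓ / x) * (α' ℓ / x) := by
    have := hpsd (-(α' ℓ / x) / x) 1
    rw [← hxx] at this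
    calc (0:ℝ) ≤ _ := this
      _ = _ := by field_simp; ring
  refine ⟨α, α', β, β', x, α' ℓ / x, Real.sqrt (β' ℓ - (α' ℓ / x) * (α' ℓ / x)), hα, hβ, hα0, hα1,
    hβ0, hβ1, hxx.symm, ?_, hy.symm, ?_⟩
  · rw [hy, hs]
  · rw [Real.mul_self_sqrt hz]
    ring

/-! ### Points of the completion: vertices, edges and the boundary. -/

namespace MetricGraph

variable {V : Type*} (G : MetricGraph V)

theorem src_ne_tgt (e : G.Edge) : G.src e ≠ G.tgt e := by
  have h := e.2
  rw [← G.ends e, SimpleGraph.mem_edgeSet] at h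
  exact h.ne

theorem mem_edge_iff {v : V} {e : G.Edge} : v ∈ (e : Sym2 V) ↔ G.src e = v ∨ G.tgt e = v := by
  rw [← G.ends e, Sym2.mem_iff, eq_comm, eq_comm (a := v)]

theorem finite_incident (v : V) : {e : G.Edge | v ∈ (e : Sym2 V)}.Finite := by
  have h : ((fun w => s(v, w)) '' G.graph.neighborSet v).Finite := (G.locallyFinite v).image _
  refine (h.preimage (Subtype.val_injective.injOn (s := univ) |>.mono (subset_univ _))).subset ?_
  intro e he
  obtain ⟨w, hw⟩ := Sym2.mem_iff_exists.1 he
  refine ⟨w, ?_, hw.symm⟩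
  have := e.2
  rw [hw] at this
  exact this

variable {G}

theorem dist_le_of_path {x y : G.Point} {L : ℝ} (h : G.Path x y L) : dist x y ≤ L :=
  csInf_le ⟨0, fun _ h => Path.nonneg h⟩ h

theorem exists_path_lt (x y : G.Point) {ε : ℝ} (hε : 0 < ε) : ∃ L, G.Path x y L ∧ L < dist x y + ε :=
  Real.lt_sInf_add_pos (s := {L | G.Path x y L}) (G.exists_path x y) hε

theorem dist_le_of_edge_eq {x y : G.Point} (h : x.edge = y.edge) :
    dist x y ≤ |x.pos - y.pos| := by
  have := dist_le_of_path (Path.seg h (Path.nil y))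
  rwa [add_zero] at this

theorem coe_eq_of_isVertex {x y : G.Point} {v : V} (hx : x.IsVertex v) (hy : y.IsVertex v) :
    (x : G.Compl) = y := by
  refine eq_of_dist_eq_zero (le_antisymm ?_ dist_nonneg)
  rw [UniformSpace.Completion.dist_eq]
  exact dist_le_of_path (Path.turn v hx hy (Path.nil y))

/-- A function that is Lipschitz on each edge is Lipschitz. -/
theorem abs_sub_le_of_edge {f : G.Point → ℝ} {K : ℝ} (hK : 0 ≤ K)
    (h1 : ∀ x y : G.Point, x.edge = y.edge → |f x - f y| ≤ K * |x.pos - y.pos|)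
    (h2 : ∀ (v : V) (x y : G.Point), x.IsVertex v → y.IsVertex v → f x = f y) (x y : G.Point) :
    |f x - f y| ≤ K * dist x y := by
  have h : ∀ {x y : G.Point} {L : ℝ}, G.Path x y L → |f x - f y| ≤ K * L := by
    intro x y L p
    induction p with
    | nil x => simp
    | @seg x y z L h p ih =>
      have := abs_sub_le (f x) (f y) (f z)
      linarith [h1 x y h]
    | turn v hx hy p ih => rwa [h2 v _ _ hx hy]
  refine le_of_forall_pos_le_add fun ε hε => ?_
  obtain ⟨L, hL, hlt⟩ := exists_path_lt x y (ε := ε / (K + 1)) (by positivity)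
  have h3 : K * (ε / (K + 1)) ≤ ε := by
    rw [mul_div_assoc', div_le_iff₀ (by positivity)]
    nlinarith
  have := mul_le_mul_of_nonneg_left hlt.le hK
  linarith [h hL]

theorem lipschitzWith_of_edge {f : G.Point → ℝ} {K : ℝ} (hK : 0 ≤ K)
    (h1 : ∀ x y : G.Point, x.edge = y.edge → |f x - f y| ≤ K * |x.pos - y.pos|)
    (h2 : ∀ (v : V) (x y : G.Point), x.IsVertex v → y.IsVertex v → f x = f y) :
    LipschitzWith ⟨K, hK⟩ f :=
  LipschitzWith.of_dist_le_mul fun x y => by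
    rw [Real.dist_eq]
    exact abs_sub_le_of_edge hK h1 h2 x y

open Classical in
/-- The distance to the endpoints of the edge `e`, extended by `0`. -/
noncomputable def edgeTent (e : G.Edge) (x : G.Point) : ℝ :=
  if x.edge = e then min x.pos (G.len x.edge - x.pos) else 0

theorem edgeTent_of_isVertex (e : G.Edge) {x : G.Point} {v : V} (hx : x.IsVertex v) :
    edgeTent e x = 0 := by
  unfold edgeTent
  split_ifs with h
  · rcases hx with hx | hx
    · rw [hx.1, sub_zero, min_eq_left (G.len_pos _).le]
    · rw [hx.1, sub_self, min_eq_right (G.len_pos _).le]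
  · rfl

/-- Being Lipschitz, the tent agrees at points at distance zero and extends to the completion, where
it separates the interior of an edge from all vertices and all other edges. -/
theorem lipschitzWith_edgeTent (e : G.Edge) : LipschitzWith 1 (edgeTent e) := by
  refine lipschitzWith_of_edge (K := 1) zero_le_one (fun x y h => ?_) (fun v x y hx hy => ?_)
  · unfold edgeTent
    by_cases hx : x.edge = e
    · rw [if_pos hx, if_pos (h ▸ hx), h]
      have := abs_min_sub_min_le_max x.pos (G.len y.edge - x.pos) y.pos (G.len y.edge - y.pos)
      rwa [show G.len y.edge - x.pos - (G.len y.edge - y.pos) = -(x.pos - y.pos) by ring, abs_neg,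
        max_self, ← one_mul |x.pos - y.pos|] at this
    · rw [if_neg hx, if_neg (h ▸ hx)]
      simp
  · rw [edgeTent_of_isVertex e hx, edgeTent_of_isVertex e hy]

theorem edgeTent_pos {x : G.Point} (hx : ∀ v, ¬ x.IsVertex v) : 0 < edgeTent x.edge x := by
  unfold edgeTent
  rw [if_pos rfl]
  refine lt_min (lt_of_le_of_ne x.nonneg fun h => ?_) (sub_pos.2 (lt_of_le_of_ne x.le_len ?_))
  · exact hx _ (Or.inl ⟨h.symm, rfl⟩)
  · exact fun h => hx _ (Or.inr ⟨h, rfl⟩)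

open Classical in
/-- The tent function of height `δ` at the vertex `v`. -/
noncomputable def vertexTent (v : V) (δ : ℝ) (x : G.Point) : ℝ :=
  if G.src x.edge = v then max 0 (δ - x.pos)
  else if G.tgt x.edge = v then max 0 (δ - (G.len x.edge - x.pos)) else 0

/-- The bound on `δ` makes the tent reach zero no later than the far end of each incident edge; the
absence of loops makes the far end a different vertex. -/
theorem vertexTent_of_isVertex {v : V} {δ : ℝ} (hδ0 : 0 ≤ δ)
    (hδ : ∀ e : G.Edge, v ∈ (e : Sym2 V) → δ ≤ G.len e) {x : G.Point} {w : V}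
    (hx : x.IsVertex w) [Decidable (w = v)] :
    vertexTent v δ x = if w = v then δ else 0 := by
  have hs : ∀ h : G.src x.edge = v, δ ≤ G.len x.edge := fun h => hδ _ (G.mem_edge_iff.2 (Or.inl h))
  have ht : ∀ h : G.tgt x.edge = v, δ ≤ G.len x.edge := fun h => hδ _ (G.mem_edge_iff.2 (Or.inr h))
  have hne := G.src_ne_tgt x.edge
  unfold vertexTent
  rcases hx with ⟨h0, rfl⟩ | ⟨h0, rfl⟩
  · rw [h0, sub_zero, sub_zero, max_eq_right hδ0]
    split_ifs with h1 h2
    · rfl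
    · exact max_eq_left (by linarith [ht h2])
    · rfl
  · rw [h0, sub_self, sub_zero, max_eq_right hδ0]
    split_ifs with h1 h2 h2
    · exact absurd (h1.trans h2.symm) hne
    · exact max_eq_left (by linarith [hs h1])
    · rfl
    · rfl

theorem lipschitzWith_vertexTent {v : V} {δ : ℝ} (hδ0 : 0 ≤ δ)
    (hδ : ∀ e : G.Edge, v ∈ (e : Sym2 V) → δ ≤ G.len e) :
    LipschitzWith 1 (vertexTent (G := G) v δ) := by
  classical
  refine lipschitzWith_of_edge (K := 1) zero_le_one (fun x y h => ?_) (fun w x y hx hy => ?_)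
  · unfold vertexTent
    rw [h, one_mul]
    split_ifs with h1 h2
    · have := abs_max_sub_max_le_max 0 (δ - x.pos) 0 (δ - y.pos)
      rwa [sub_self, abs_zero, show δ - x.pos - (δ - y.pos) = -(x.pos - y.pos) by ring, abs_neg,
        max_eq_right (abs_nonneg (x.pos - y.pos))] at this
    · have := abs_max_sub_max_le_max 0 (δ - (G.len y.edge - x.pos)) 0 (δ - (G.len y.edge - y.pos))
      rwa [sub_self, abs_zero, show δ - (G.len y.edge - x.pos) - (δ - (G.len y.edge - y.pos)) =
        x.pos - y.pos by ring, max_eq_right (abs_nonneg (x.pos - y.pos))] at this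
    · simp
  · rw [vertexTent_of_isVertex hδ0 hδ hx, vertexTent_of_isVertex hδ0 hδ hy]

variable (G) in
theorem exists_le_len (v : V) :
    ∃ δ > 0, ∀ e : G.Edge, v ∈ (e : Sym2 V) → δ ≤ G.len e := by
  rcases {e : G.Edge | v ∈ (e : Sym2 V)}.eq_empty_or_nonempty with h | h
  · refine ⟨1, one_pos, fun e he => ?_⟩
    have : e ∈ ({e : G.Edge | v ∈ (e : Sym2 V)}) := he
    rw [h] at this
    exact this.elim
  · obtain ⟨e, -, he⟩ := exists_min_image _ G.len (G.finite_incident v) h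
    exact ⟨G.len e, G.len_pos e, he⟩

theorem dist_eq_zero_of_coe_eq {x y : G.Point} (h : (x : G.Compl) = y) : dist x y = 0 := by
  rw [← UniformSpace.Completion.dist_eq, h, dist_self]

theorem IsVertex.eq {x y : G.Point} {v w : V} (hx : x.IsVertex v) (hy : y.IsVertex w)
    (h : (x : G.Compl) = y) : v = w := by
  classical
  obtain ⟨δ, hδ, hle⟩ := G.exists_le_len v
  have h1 := (lipschitzWith_vertexTent hδ.le hle).dist_le_mul x y
  rw [dist_eq_zero_of_coe_eq h, mul_zero, Real.dist_eq,
    vertexTent_of_isVertex hδ.le hle hx, vertexTent_of_isVertex hδ.le hle hy, if_pos rfl] at h1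
  by_contra hne
  rw [if_neg (Ne.symm hne), sub_zero, abs_of_pos hδ] at h1
  linarith

theorem edgeTent_eq_of_coe_eq (e : G.Edge) {x y : G.Point} (h : (x : G.Compl) = y) :
    edgeTent e x = edgeTent e y := by
  have h1 := (lipschitzWith_edgeTent e).dist_le_mul x y
  rw [dist_eq_zero_of_coe_eq h, mul_zero] at h1
  exact eq_of_dist_eq_zero (le_antisymm h1 dist_nonneg)

/-- A point with the same image in the completion as a vertex is a vertex. -/
theorem isVertex_of_coe_eq {x y : G.Point} {v : V} (hx : x.IsVertex v) (h : (x : G.Compl) = y) :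
    y.IsVertex v := by
  by_cases hy : ∃ w, y.IsVertex w
  · obtain ⟨w, hw⟩ := hy
    rwa [IsVertex.eq hx hw h]
  · push Not at hy
    have h1 := edgeTent_pos hy
    rw [← edgeTent_eq_of_coe_eq y.edge h, edgeTent_of_isVertex _ hx] at h1
    exact absurd h1 (lt_irrefl _)

/-- At a vertex this is local finiteness. An interior point lies on its own edge only, because the
tent of that edge is positive there and zero on every other edge. -/
theorem finite_edges_through (x : G.Point) :
    {e : G.Edge | ∃ y : G.Point, y.edge = e ∧ (y : G.Compl) = x}.Finite := by
  by_cases hx : ∃ v, x.IsVertex v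
  · obtain ⟨v, hv⟩ := hx
    refine (G.finite_incident v).subset ?_
    rintro e ⟨y, rfl, hy⟩
    refine G.mem_edge_iff.2 ?_
    rcases isVertex_of_coe_eq hv hy.symm with h | h
    · exact Or.inl h.2
    · exact Or.inr h.2
  · push Not at hx
    refine (finite_singleton x.edge).subset ?_
    rintro e ⟨y, rfl, hy⟩
    have h1 := edgeTent_pos hx
    rw [← edgeTent_eq_of_coe_eq x.edge hy] at h1
    by_contra hne
    rw [edgeTent, if_neg (by exact hne)] at h1
    exact lt_irrefl _ h1

variable (G)

/-- The point of the edge `e` with coordinate `t`. -/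
def mkPt (e : G.Edge) (t : ℝ) (ht : t ∈ Icc 0 (G.len e)) : G.Point := ⟨e, t, ht.1, ht.2⟩

theorem pt_eq {e : G.Edge} {t : ℝ} (ht : t ∈ Icc 0 (G.len e)) :
    G.pt e t = (G.mkPt e t ht : G.Point) := by
  unfold pt mkPt
  congr
  rw [min_eq_left ht.2, max_eq_right ht.1]

theorem pt_pos (x : G.Point) : G.pt x.edge x.pos = x :=
  G.pt_eq (e := x.edge) ⟨x.nonneg, x.le_len⟩

theorem isVertex_mk_zero (e : G.Edge) :
    (G.mkPt e 0 (left_mem_Icc.2 (G.len_pos e).le)).IsVertex (G.src e) := Or.inl ⟨rfl, rfl⟩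

theorem isVertex_mk_len (e : G.Edge) :
    (G.mkPt e (G.len e) (right_mem_Icc.2 (G.len_pos e).le)).IsVertex (G.tgt e) := Or.inr ⟨rfl, rfl⟩

theorem lipschitzWith_pt (e : G.Edge) : LipschitzWith 1 (G.pt e) := by
  refine LipschitzWith.of_dist_le_mul fun s t => ?_
  unfold pt
  rw [UniformSpace.Completion.dist_eq, NNReal.coe_one, one_mul, Real.dist_eq]
  refine (dist_le_of_edge_eq (G := G) (by rfl)).trans ?_
  have h1 := abs_max_sub_max_le_max 0 (min s (G.len e)) 0 (min t (G.len e))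
  have h2 := abs_min_sub_min_le_max s (G.len e) t (G.len e)
  simp only [sub_self, abs_zero] at h1 h2
  rw [max_eq_right (abs_nonneg (min s (G.len e) - min t (G.len e)))] at h1
  rw [max_eq_left (abs_nonneg (s - t))] at h2
  exact h1.trans h2

theorem continuous_pt (e : G.Edge) : Continuous (G.pt e) := (G.lipschitzWith_pt e).continuous

/-- The vertices, as points of the completion. -/
def vertexSet : Set G.Compl := {z | ∃ (v : V) (x : G.Point), x.IsVertex v ∧ z = x}

theorem dense_carrier : Dense G.carrier := UniformSpace.Completion.denseRange_coe

variable {G}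

/-- If a ball around `z` had no vertices, a graph point near `z` would be so deep inside its edge
that the graph points of a smaller ball all lie on that edge. The edge is compact, so it would
contain `z`. Hence boundary values of continuous functions are limits of vertex values. -/
theorem mem_closure_vertexSet {z : G.Compl} (hz : z ∉ G.carrier) : z ∈ closure G.vertexSet := by
  by_contra hcl
  rw [Metric.mem_closure_iff] at hcl
  push Not at hcl
  obtain ⟨r, hr, hball⟩ := hcl
  have hx : ∃ x : G.Point, dist z (x : G.Compl) < r / 4 := by
    obtain ⟨_, hx, ⟨x, rfl⟩⟩ := Metric.dense_iff.1 G.dense_carrier z (r / 4) (by positivity)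
    exact ⟨x, by rwa [dist_comm]⟩
  obtain ⟨x, hx⟩ := hx
  have hv : ∀ (y : G.Point) (v : V), y.IsVertex v → r * (3 / 4) ≤ dist x y := by
    intro y v hy
    have h1 := hball y ⟨v, y, hy, rfl⟩
    have h2 := dist_triangle z (x : G.Compl) y
    rw [UniformSpace.Completion.dist_eq] at h2
    linarith
  have htent : r * (3 / 4) ≤ edgeTent x.edge x := by
    rw [edgeTent, if_pos rfl]
    refine le_min ?_ ?_
    · refine (hv _ _ (G.isVertex_mk_zero x.edge)).trans ((dist_le_of_edge_eq (by rfl)).trans ?_)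
      simp only [mkPt]
      rw [sub_zero, abs_of_nonneg x.nonneg]
    · refine (hv _ _ (G.isVertex_mk_len x.edge)).trans ((dist_le_of_edge_eq (by rfl)).trans ?_)
      simp only [mkPt]
      rw [abs_of_nonpos (by linarith [x.le_len]), neg_sub]
  have hsub : G.carrier ∩ Metric.ball z (r / 4) ⊆ G.pt x.edge '' Icc 0 (G.len x.edge) := by
    rintro _ ⟨⟨y, rfl⟩, hy⟩
    have hedge : y.edge = x.edge := by
      by_contra hne
      have h1 := (lipschitzWith_edgeTent x.edge).dist_le_mul x y
      have h0 : edgeTent x.edge y = 0 := if_neg hne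
      rw [h0, Real.dist_eq, sub_zero, NNReal.coe_one, one_mul,
        ← UniformSpace.Completion.dist_eq] at h1
      have h2 := dist_triangle (x : G.Compl) z y
      rw [Metric.mem_ball, dist_comm] at hy
      rw [dist_comm (x : G.Compl) z] at h2
      linarith [le_abs_self (edgeTent x.edge x)]
    rw [← hedge]
    exact ⟨y.pos, ⟨y.nonneg, y.le_len⟩, G.pt_pos y⟩
  have hclosed : IsClosed (G.pt x.edge '' Icc 0 (G.len x.edge)) :=
    (isCompact_Icc.image (G.continuous_pt _)).isClosed
  have h1 : z ∈ closure (G.carrier ∩ Metric.ball z (r / 4)) := by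
    rw [inter_comm]
    exact Metric.isOpen_ball.inter_closure
      ⟨Metric.mem_ball_self (by positivity), G.dense_carrier z⟩
  obtain ⟨t, ht, rfl⟩ := hclosed.closure_subset_iff.2 hsub h1
  exact hz ⟨_, (G.pt_eq ht).symm⟩

theorem boundary_subset_closure : G.boundary ⊆ closure G.vertexSet := by
  rintro z (⟨v, x, -, hx, rfl⟩ | hz)
  · exact subset_closure ⟨v, x, hx, rfl⟩
  · exact mem_closure_vertexSet hz

/-- A Lipschitz function on the graph, extended to the completion. -/
theorem exists_continuous_extension {f : G.Point → ℝ} (hf : LipschitzWith 1 f) :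
    ∃ F : G.Compl → ℝ, Continuous F ∧ ∀ x : G.Point, F x = f x :=
  ⟨UniformSpace.Completion.extension f, UniformSpace.Completion.continuous_extension,
    fun x => UniformSpace.Completion.extension_coe hf.uniformContinuous x⟩

/-- Boundary points are limits of vertices. The set where a tent is positive contains no vertex if
the tent sits on an edge, and a single one if it sits at a vertex, so it is a neighborhood free of
boundary points. -/
theorem isClosed_boundary : IsClosed G.boundary := by
  classical
  rw [← isOpen_compl_iff, isOpen_iff_mem_nhds]
  intro z hz
  have hzc : z ∈ G.carrier := by
    by_contra h
    exact hz (Or.inr h)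
  obtain ⟨x, rfl⟩ := hzc
  by_cases hx : ∃ v, x.IsVertex v
  · obtain ⟨v, hv⟩ := hx
    obtain ⟨δ, hδ, hle⟩ := G.exists_le_len v
    obtain ⟨F, hF, hFx⟩ := exists_continuous_extension (lipschitzWith_vertexTent hδ.le hle)
    have hopen : IsOpen {y | 0 < F y} := isOpen_lt continuous_const hF
    refine mem_of_superset (hopen.mem_nhds (x := (x : G.Compl)) ?_) ?_
    · rw [mem_ofPred_eq, hFx, vertexTent_of_isVertex hδ.le hle hv, if_pos rfl]
      exact hδ
    · intro y hy hyb
      have h1 : y ∈ closure ({y | 0 < F y} ∩ G.vertexSet) :=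
        hopen.inter_closure ⟨hy, boundary_subset_closure hyb⟩
      have h2 : {y | 0 < F y} ∩ G.vertexSet ⊆ {(x : G.Compl)} := by
        rintro _ ⟨hw0, w, x', hw, rfl⟩
        rw [mem_ofPred_eq, hFx, vertexTent_of_isVertex hδ.le hle hw] at hw0
        by_cases hwv : w = v
        · subst hwv
          exact coe_eq_of_isVertex hw hv
        · rw [if_neg hwv] at hw0
          exact absurd hw0 (lt_irrefl _)
      have h3 := isClosed_singleton.closure_subset_iff.2 h2 h1
      rw [mem_singleton_iff] at h3
      exact hz (h3 ▸ hyb)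
  · push Not at hx
    obtain ⟨F, hF, hFx⟩ := exists_continuous_extension (lipschitzWith_edgeTent x.edge)
    have hopen : IsOpen {y | 0 < F y} := isOpen_lt continuous_const hF
    refine mem_of_superset (hopen.mem_nhds (x := (x : G.Compl)) ?_) ?_
    · rw [mem_ofPred_eq, hFx]
      exact edgeTent_pos hx
    · intro y hy hyb
      obtain ⟨_, hw0, w, x', hw, rfl⟩ := mem_closure_iff.1 (boundary_subset_closure hyb) _ hopen hy
      rw [mem_ofPred_eq, hFx, edgeTent_of_isVertex _ hw] at hw0
      exact lt_irrefl _ hw0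

end MetricGraph

/-! ### Hölder continuity from finite energy. -/

/-- The image has measure at most `∫ |u'|` over `S`, and `|w| ≤ l / 2 + w² / (2 l)`. Keeping `l`
free lets lengths and energies be summed over the edges separately before optimizing. -/
theorem volume_image_le {u w : ℝ → ℝ} {ℓ c l : ℝ} (hℓ : 0 ≤ ℓ)
    (hd : ∀ t ∈ Icc 0 ℓ, HasDerivWithinAt u (w t) (Icc 0 ℓ) t)
    (hw : ContinuousOn w (Icc 0 ℓ)) (hc : ∫ t in 0..ℓ, w t ^ 2 ≤ c) (hl : 0 < l)
    {S : Set ℝ} (hS : MeasurableSet S) (hSs : S ⊆ Icc 0 ℓ) :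
    volume (u '' S) ≤ ENNReal.ofReal (l / 2) * volume S + ENNReal.ofReal (c / (2 * l)) := by
  have h1 := addHaar_image_le_lintegral_abs_det_fderiv volume hS
    (fun t ht => ((hd t (hSs ht)).mono hSs).hasFDerivWithinAt)
  refine h1.trans ?_
  have h2 : ∫⁻ t in S, ENNReal.ofReal |(ContinuousLinearMap.toSpanSingleton ℝ (w t)).det| ≤
      ∫⁻ t in S, (ENNReal.ofReal (l / 2) + ENNReal.ofReal (w t ^ 2 / (2 * l))) := by
    refine lintegral_mono fun t => ?_
    rw [← ENNReal.ofReal_add (by positivity) (by positivity), ContinuousLinearMap.det_toSpanSingleton]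
    refine ENNReal.ofReal_le_ofReal ?_
    have : l / 2 + w t ^ 2 / (2 * l) - |w t| = (l - |w t|) ^ 2 / (2 * l) := by
      field_simp
      rw [sub_sq, sq_abs]
      ring
    have h3 : 0 ≤ (l - |w t|) ^ 2 / (2 * l) := by positivity
    linarith
  refine h2.trans ?_
  rw [lintegral_add_left measurable_const, setLIntegral_const]
  refine add_le_add_right ?_ _
  have hint : IntegrableOn (fun t => w t ^ 2 / (2 * l)) (Icc 0 ℓ) :=
    ((hw.pow 2).div_const _).integrableOn_compact isCompact_Icc
  calc ∫⁻ t in S, ENNReal.ofReal (w t ^ 2 / (2 * l))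
      ≤ ∫⁻ t in Icc 0 ℓ, ENNReal.ofReal (w t ^ 2 / (2 * l)) := lintegral_mono_set hSs
    _ = ENNReal.ofReal (∫ t in Icc 0 ℓ, w t ^ 2 / (2 * l)) :=
        (ofReal_integral_eq_lintegral_ofReal hint
          (Eventually.of_forall fun t => by positivity)).symm
    _ ≤ _ := by
        refine ENNReal.ofReal_le_ofReal ?_
        rw [integral_div, integral_Icc_eq_integral_Ioc, ← intervalIntegral.integral_of_le hℓ]
        gcongr

namespace MetricGraph

variable {V : Type*} {G : MetricGraph V}

/-- A path of length `L` between `x` and `y` gives a set of total length at most `L` on which `u`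
takes all values between `u x` and `u y`. -/
theorem exists_sets_of_path {U : G.Edge → ℝ → ℝ} (hU : ∀ e, ContinuousOn (U e) (Icc 0 (G.len e)))
    (hv : ∀ (v : V) (x y : G.Point), x.IsVertex v → y.IsVertex v →
      U x.edge x.pos = U y.edge y.pos) {x y : G.Point} {L : ℝ} (p : G.Path x y L) :
    ∃ S : G.Edge → Set ℝ, (∀ e, MeasurableSet (S e) ∧ S e ⊆ Icc 0 (G.len e)) ∧
      ∑' e, volume (S e) ≤ ENNReal.ofReal L ∧
      uIcc (U x.edge x.pos) (U y.edge y.pos) ⊆ ⋃ e, U e '' S e := by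
  classical
  have key : ∀ (e : G.Edge) (a b : ℝ), a ∈ Icc 0 (G.len e) → b ∈ Icc 0 (G.len e) →
      ∃ T : G.Edge → Set ℝ, (∀ e, MeasurableSet (T e) ∧ T e ⊆ Icc 0 (G.len e)) ∧
      ∑' e, volume (T e) = ENNReal.ofReal |a - b| ∧ uIcc (U e a) (U e b) ⊆ ⋃ e, U e '' T e := by
    intro e a b ha hb
    have hsub : uIcc a b ⊆ Icc 0 (G.len e) := uIcc_subset_Icc ha hb
    refine ⟨fun e' => if e' = e then uIcc a b else ∅, fun e' => ?_, ?_, ?_⟩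
    · by_cases h : e' = e
      · subst h
        simp only [if_true]
        exact ⟨measurableSet_uIcc, hsub⟩
      · simp [h]
    · rw [tsum_eq_single e fun e' he' => by simp [he']]
      simp only [if_true]
      rw [uIcc, Real.volume_Icc, max_sub_min_eq_abs, abs_sub_comm]
    · intro r hr
      refine mem_iUnion.2 ⟨e, ?_⟩
      simp only [if_true]
      exact intermediate_value_uIcc ((hU e).mono hsub) hr
  induction p with
  | nil x =>
    obtain ⟨T, h1, h2, h3⟩ := key x.edge x.pos x.pos ⟨x.nonneg, x.le_len⟩ ⟨x.nonneg, x.le_len⟩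
    exact ⟨T, h1, by simp [h2], h3⟩
  | @seg x y z L h p ih =>
    obtain ⟨S, hS1, hS2, hS3⟩ := ih
    obtain ⟨T, h1, h2, h3⟩ := key y.edge x.pos y.pos ⟨x.nonneg, h ▸ x.le_len⟩ ⟨y.nonneg, y.le_len⟩
    -- A path may run over an edge several times; taking the union means that the energy of the edge
    -- is counted once.
    refine ⟨fun e => T e ∪ S e, fun e => ⟨(h1 e).1.union (hS1 e).1, union_subset (h1 e).2 (hS1 e).2⟩,
      ?_, ?_⟩
    · rw [ENNReal.ofReal_add (abs_nonneg _) p.nonneg, ← h2]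
      refine le_trans ?_ (add_le_add_right hS2 _)
      rw [← ENNReal.tsum_add]
      exact ENNReal.tsum_le_tsum fun e => measure_union_le _ _
    · refine (uIcc_subset_uIcc_union_uIcc (b := U y.edge y.pos)).trans ?_
      rw [h]
      simp only [image_union, iUnion_union_distrib]
      exact union_subset_union h3 hS3
  | turn v hx hy p ih =>
    rw [hv v _ _ hx hy]
    exact ih

/-- A function of finite energy is Hölder continuous of exponent `1 / 2`. -/
theorem sq_sub_le_energy_mul_dist [Countable V] {U W : G.Edge → ℝ → ℝ} {c : G.Edge → ℝ}
    (hd : ∀ e, ∀ t ∈ Icc 0 (G.len e), HasDerivWithinAt (U e) (W e t) (Icc 0 (G.len e)) t)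
    (hW : ∀ e, ContinuousOn (W e) (Icc 0 (G.len e)))
    (hc : ∀ e, ∫ t in 0..(G.len e), W e t ^ 2 ≤ c e) (hsum : Summable c)
    (hv : ∀ (v : V) (x y : G.Point), x.IsVertex v → y.IsVertex v →
      U x.edge x.pos = U y.edge y.pos) (x y : G.Point) :
    (U x.edge x.pos - U y.edge y.pos) ^ 2 ≤ (∑' e, c e) * dist x y := by
  have hcount : Countable G.Edge := Subtype.countable
  have hc0 : ∀ e, 0 ≤ c e := fun e =>
    (intervalIntegral.integral_nonneg (G.len_pos e).le fun _ _ => sq_nonneg _).trans (hc e)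
  have hU : ∀ e, ContinuousOn (U e) (Icc 0 (G.len e)) :=
    fun e t ht => (hd e t ht).continuousWithinAt
  set d := |U x.edge x.pos - U y.edge y.pos| with hdef
  set E := ∑' e, c e with hE
  have hE0 : 0 ≤ E := tsum_nonneg hc0
  have h1 : ∀ L, G.Path x y L → ∀ l > 0, d ≤ l / 2 * L + E / (2 * l) := by
    intro L p l hl
    obtain ⟨S, hS1, hS2, hS3⟩ := exists_sets_of_path hU hv p
    have h2 : ENNReal.ofReal d ≤ ENNReal.ofReal (l / 2 * L + E / (2 * l)) := by
      calc ENNReal.ofReal d = volume (uIcc (U x.edge x.pos) (U y.edge y.pos)) := by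
            rw [uIcc, Real.volume_Icc, max_sub_min_eq_abs, abs_sub_comm]
        _ ≤ volume (⋃ e, U e '' S e) := measure_mono hS3
        _ ≤ ∑' e, volume (U e '' S e) := measure_iUnion_le _
        _ ≤ ∑' e, (ENNReal.ofReal (l / 2) * volume (S e) + ENNReal.ofReal (c e / (2 * l))) :=
            ENNReal.tsum_le_tsum fun e => volume_image_le (G.len_pos e).le (hd e) (hW e) (hc e) hl
              (hS1 e).1 (hS1 e).2
        _ = ENNReal.ofReal (l / 2) * ∑' e, volume (S e) + ENNReal.ofReal (E / (2 * l)) := by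
            rw [ENNReal.tsum_add, ENNReal.tsum_mul_left, hE, ← tsum_div_const,
              ENNReal.ofReal_tsum_of_nonneg (fun e => div_nonneg (hc0 e) (by positivity))
                (hsum.div_const _)]
        _ ≤ ENNReal.ofReal (l / 2) * ENNReal.ofReal L + ENNReal.ofReal (E / (2 * l)) := by
            gcongr
        _ = _ := by
            rw [← ENNReal.ofReal_mul (by positivity), ← ENNReal.ofReal_add
              (mul_nonneg (by positivity) p.nonneg) (by positivity)]
    exact (ENNReal.ofReal_le_ofReal_iff
      (add_nonneg (mul_nonneg (by positivity) p.nonneg) (by positivity))).1 h2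
  -- The bounds for all `l` say that a quadratic polynomial is nonnegative; its discriminant gives
  -- the claim.
  have h3 : ∀ l : ℝ, 0 ≤ dist x y * (l * l) + (-2 * d) * l + E := by
    intro l
    rcases le_or_gt l 0 with hl | hl
    · have := mul_nonneg (abs_nonneg (U x.edge x.pos - U y.edge y.pos)) (neg_nonneg.2 hl)
      have := mul_nonneg (dist_nonneg (x := x) (y := y)) (mul_self_nonneg l)
      rw [← hdef] at *
      linarith
    · refine le_of_forall_pos_le_add fun ε hε => ?_
      obtain ⟨L, hL, hlt⟩ := exists_path_lt x y (ε := ε / (l * l)) (by positivity)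
      have h4 := h1 L hL l hl
      have h5 : l / 2 * L + E / (2 * l) = (L * (l * l) + E) / (2 * l) := by
        field_simp
      rw [h5, le_div_iff₀ (by positivity)] at h4
      have h6 : L * (l * l) ≤ dist x y * (l * l) + ε := by
        have := mul_le_mul_of_nonneg_right hlt.le (mul_self_nonneg l)
        rwa [add_mul, div_mul_cancel₀ _ (by positivity)] at this
      linarith
  have h7 := discrim_le_zero h3
  rw [discrim] at h7
  rw [← sq_abs, ← hdef]
  linarith

end MetricGraph

/-! ### Separation by finite frontiers and the construction of test functions. -/

namespace MetricGraph

variable {V : Type*} {G : MetricGraph V}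

/-- Weak connectedness gives this for two points. Open sets with finite frontier in the graph are
stable under finite unions and intersections, so compactness extends it first to a point and `K₂`,
then to `K₁` and `K₂`. -/
theorem exists_isOpen_finite_frontier (hweak : G.WeaklyConnected) {K₁ K₂ : Set G.Compl}
    (h₁ : IsCompact K₁) (h₂ : IsCompact K₂) (hd : Disjoint K₁ K₂) :
    ∃ A : Set G.Compl, IsOpen A ∧ (frontier A).Finite ∧ frontier A ⊆ G.carrier ∧ K₁ ⊆ A ∧
      Disjoint (closure A) K₂ := by
  have hinter : ∀ A B : Set G.Compl, (frontier A).Finite → frontier A ⊆ G.carrier →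
      (frontier B).Finite → frontier B ⊆ G.carrier →
      (frontier (A ∩ B)).Finite ∧ frontier (A ∩ B) ⊆ G.carrier := by
    intro A B hA hA' hB hB'
    have : frontier (A ∩ B) ⊆ frontier A ∪ frontier B := (frontier_inter_subset A B).trans
      (union_subset_union inter_subset_left inter_subset_right)
    exact ⟨(hA.union hB).subset this, this.trans (union_subset hA' hB')⟩
  have hunion : ∀ A B : Set G.Compl, (frontier A).Finite → frontier A ⊆ G.carrier →
      (frontier B).Finite → frontier B ⊆ G.carrier →
      (frontier (A ∪ B)).Finite ∧ frontier (A ∪ B) ⊆ G.carrier := by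
    intro A B hA hA' hB hB'
    have : frontier (A ∪ B) ⊆ frontier A ∪ frontier B := (frontier_union_subset A B).trans
      (union_subset_union inter_subset_left inter_subset_right)
    exact ⟨(hA.union hB).subset this, this.trans (union_subset hA' hB')⟩
  have hpt : ∀ x ∈ K₁, ∃ A : Set G.Compl, IsOpen A ∧ (frontier A).Finite ∧
      frontier A ⊆ G.carrier ∧ x ∈ A ∧ Disjoint (closure A) K₂ := by
    intro x hx
    refine h₂.induction_on (p := fun s => ∃ A : Set G.Compl, IsOpen A ∧ (frontier A).Finite ∧
      frontier A ⊆ G.carrier ∧ x ∈ A ∧ Disjoint (closure A) s) ?_ ?_ ?_ ?_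
    · exact ⟨univ, isOpen_univ, by simp, by simp, mem_univ _, disjoint_empty _⟩
    · rintro s t hst ⟨A, h1, h2, h3, h4, h5⟩
      exact ⟨A, h1, h2, h3, h4, h5.mono_right hst⟩
    · rintro s t ⟨A, h1, h2, h3, h4, h5⟩ ⟨B, h1', h2', h3', h4', h5'⟩
      obtain ⟨h6, h7⟩ := hinter A B h2 h3 h2' h3'
      exact ⟨A ∩ B, h1.inter h1', h6, h7, ⟨h4, h4'⟩, disjoint_union_right.2
        ⟨h5.mono_left (closure_mono inter_subset_left),
          h5'.mono_left (closure_mono inter_subset_right)⟩⟩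
    · intro y hy
      have hne : x ≠ y := fun h => disjoint_left.1 hd hx (h ▸ hy)
      obtain ⟨W, hW, hWc, A, B, hA, hB, hAB, hU, hxA, hyB⟩ := hweak x y hne
      have hf : frontier A ⊆ W := by
        rw [hA.frontier_eq]
        rintro z ⟨hz, hzA⟩
        by_contra hzW
        have : z ∈ A ∪ B := hU ▸ hzW
        rcases this with h | h
        · exact hzA h
        · exact disjoint_left.1 (hAB.closure_left hB) hz h
      exact ⟨B, mem_nhdsWithin_of_mem_nhds (hB.mem_nhds hyB), A, hA, hW.subset hf, hf.trans hWc,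
        hxA, hAB.closure_left hB⟩
  refine h₁.induction_on (p := fun s => ∃ A : Set G.Compl, IsOpen A ∧ (frontier A).Finite ∧
      frontier A ⊆ G.carrier ∧ s ⊆ A ∧ Disjoint (closure A) K₂) ?_ ?_ ?_ ?_
  · exact ⟨∅, isOpen_empty, by simp, by simp, le_rfl, by simp⟩
  · rintro s t hst ⟨A, h1, h2, h3, h4, h5⟩
    exact ⟨A, h1, h2, h3, hst.trans h4, h5⟩
  · rintro s t ⟨A, h1, h2, h3, h4, h5⟩ ⟨B, h1', h2', h3', h4', h5'⟩
    obtain ⟨h6, h7⟩ := hunion A B h2 h3 h2' h3'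
    exact ⟨A ∪ B, h1.union h1', h6, h7, union_subset_union h4 h4', by
      rw [closure_union]
      exact disjoint_union_left.2 ⟨h5, h5'⟩⟩
  · intro x hx
    obtain ⟨A, h1, h2, h3, h4, h5⟩ := hpt x hx
    exact ⟨A, mem_nhdsWithin_of_mem_nhds (h1.mem_nhds h4), A, h1, h2, h3, le_rfl, h5⟩

/-- A smooth step from `a` to `b` on `[0, ℓ]`, constant near the endpoints. -/
noncomputable def smoothStep (ℓ a b t : ℝ) : ℝ :=
  a + (b - a) * Real.smoothTransition (3 * (t / ℓ) - 1)

theorem contDiff_smoothStep (ℓ a b : ℝ) : ContDiff ℝ ((⊤ : ℕ∞) : WithTop ℕ∞) (smoothStep ℓ a b) := by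
  unfold smoothStep
  refine contDiff_const.add (contDiff_const.mul (Real.smoothTransition.contDiff.comp ?_))
  exact (contDiff_const.mul (contDiff_id.div_const ℓ)).sub contDiff_const

theorem smoothStep_of_le {ℓ a b t : ℝ} (hℓ : 0 < ℓ) (ht : t ≤ ℓ / 3) : smoothStep ℓ a b t = a := by
  unfold smoothStep
  rw [Real.smoothTransition.zero_of_nonpos, mul_zero, add_zero]
  have : t / ℓ ≤ 1 / 3 := by
    rw [div_le_iff₀ hℓ]
    linarith
  linarith

theorem smoothStep_of_ge {ℓ a b t : ℝ} (hℓ : 0 < ℓ) (ht : ℓ - ℓ / 3 ≤ t) :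
    smoothStep ℓ a b t = b := by
  unfold smoothStep
  rw [Real.smoothTransition.one_of_one_le]
  · ring
  have : 2 / 3 ≤ t / ℓ := by
    rw [le_div_iff₀ hℓ]
    linarith
  linarith

theorem smoothStep_self (ℓ a t : ℝ) : smoothStep ℓ a a t = a := by
  unfold smoothStep
  rw [sub_self, zero_mul, add_zero]

theorem exists_lipschitz_smoothStep (ℓ a b : ℝ) :
    ∃ K ≥ 0, ∀ s ∈ Icc 0 ℓ, ∀ t ∈ Icc 0 ℓ,
      |smoothStep ℓ a b s - smoothStep ℓ a b t| ≤ K * |s - t| := by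
  obtain ⟨K, hK⟩ := ((contDiff_smoothStep ℓ a b).of_le (m := 1)
    (by exact_mod_cast le_top)).contDiffOn.exists_lipschitzOnWith (by decide)
    (convex_Icc 0 ℓ) isCompact_Icc
  refine ⟨K, K.2, fun s hs t ht => ?_⟩
  have := hK.dist_le_mul s hs t ht
  rwa [Real.dist_eq, Real.dist_eq] at this

/-- A function on the vertices that is constant on all but finitely many edges is the restriction
of an eventually flat function. -/
theorem exists_isEventuallyFlat {ψ : V → ℝ} (hS : {e : G.Edge | ψ (G.src e) ≠ ψ (G.tgt e)}.Finite) :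
    ∃ φ, G.IsEventuallyFlat φ ∧ ∀ (v : V) (x : G.Point), x.IsVertex v → φ x = ψ v := by
  classical
  choose K hK0 hK using fun e : G.Edge =>
    exists_lipschitz_smoothStep (G.len e) (ψ (G.src e)) (ψ (G.tgt e))
  set f : G.Point → ℝ := fun x =>
    smoothStep (G.len x.edge) (ψ (G.src x.edge)) (ψ (G.tgt x.edge)) x.pos with hf
  -- A global Lipschitz constant exists because the step is nonconstant on finitely many edges only.
  set C : ℝ := ∑ e ∈ hS.toFinset, K e with hC
  have hC0 : 0 ≤ C := Finset.sum_nonneg fun e _ => hK0 e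
  have hvert : ∀ (v : V) (x : G.Point), x.IsVertex v → f x = ψ v := by
    rintro v x (⟨h0, rfl⟩ | ⟨h0, rfl⟩)
    · exact smoothStep_of_le (G.len_pos _) (by have := G.len_pos x.edge; rw [h0]; positivity)
    · exact smoothStep_of_ge (G.len_pos _) (by have := G.len_pos x.edge; rw [h0]; linarith)
  have hLip : LipschitzWith ⟨C, hC0⟩ f := by
    refine lipschitzWith_of_edge hC0 (fun x y h => ?_) (fun v x y hx hy => ?_)
    · by_cases hx : ψ (G.src x.edge) = ψ (G.tgt x.edge)
      · simp only [hf]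
        rw [← h, ← hx, smoothStep_self, smoothStep_self, sub_self, abs_zero]
        positivity
      · have h1 := hK x.edge x.pos ⟨x.nonneg, x.le_len⟩ y.pos ⟨y.nonneg, h ▸ y.le_len⟩
        have h2 : K x.edge ≤ C := Finset.single_le_sum (f := K) (fun e _ => hK0 e)
          (hS.mem_toFinset.2 hx)
        simp only [hf]
        rw [← h]
        exact h1.trans (mul_le_mul_of_nonneg_right h2 (abs_nonneg _))
    · rw [hvert v x hx, hvert v y hy]
  set φ : G.Compl → ℝ := UniformSpace.Completion.extension f with hφ
  have hφx : ∀ x : G.Point, φ x = f x := fun x =>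
    UniformSpace.Completion.extension_coe hLip.uniformContinuous x
  have hedge : ∀ e : G.Edge, EqOn (G.onEdge φ e)
      (smoothStep (G.len e) (ψ (G.src e)) (ψ (G.tgt e))) (Icc 0 (G.len e)) := by
    intro e t ht
    unfold onEdge
    rw [G.pt_eq ht, hφx]
    rfl
  have hder : ∀ (e : G.Edge), ∀ t ∈ Ioo 0 (G.len e), deriv (G.onEdge φ e) t =
      deriv (smoothStep (G.len e) (ψ (G.src e)) (ψ (G.tgt e))) t := by
    intro e t ht
    refine Filter.EventuallyEq.deriv_eq ?_
    filter_upwards [Icc_mem_nhds ht.1 ht.2] with s hs using hedge e hs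
  refine ⟨φ, ⟨UniformSpace.Completion.continuous_extension, fun e => ?_, ⟨_, hS, fun e he t ht => ?_⟩,
    fun e => ⟨G.len e / 3, by have := G.len_pos e; positivity, fun t ht hlt => ?_⟩⟩, fun v x hx => ?_⟩
  · exact (contDiff_smoothStep _ _ _).contDiffOn.congr fun t ht => hedge e (Ioo_subset_Icc_self ht)
  · have he' : ψ (G.src e) = ψ (G.tgt e) := by
      by_contra h
      exact he h
    have : smoothStep (G.len e) (ψ (G.src e)) (ψ (G.tgt e)) = fun _ => ψ (G.src e) := by
      ext s
      rw [← he', smoothStep_self]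
    rw [hder e t ht, this, deriv_const]
  · rw [hder e t ht]
    rcases hlt with h | h
    · have : smoothStep (G.len e) (ψ (G.src e)) (ψ (G.tgt e)) =ᶠ[𝓝 t] fun _ => ψ (G.src e) := by
        filter_upwards [Iio_mem_nhds h] with s hs using smoothStep_of_le (G.len_pos e) (le_of_lt hs)
      rw [this.deriv_eq, deriv_const]
    · have : smoothStep (G.len e) (ψ (G.src e)) (ψ (G.tgt e)) =ᶠ[𝓝 t] fun _ => ψ (G.tgt e) := by
        filter_upwards [Ioi_mem_nhds h] with s hs using smoothStep_of_ge (G.len_pos e) (le_of_lt hs)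
      rw [this.deriv_eq, deriv_const]
  · rw [hφx, hvert v x hx]

/-- Take an open set `A` separating `Ω` from the rest of the boundary, with finite frontier in the
graph, and smooth its indicator on the vertices. An edge with one endpoint in `A` and the other
outside meets the frontier, and only finitely many edges pass through each frontier point. -/
theorem exists_isTestFunction (hcompact : CompactSpace G.Compl) (hweak : G.WeaklyConnected)
    {Ω : Set G.boundary} (hΩ : IsClopen Ω) : ∃ φ, G.IsTestFunction Ω φ := by
  classical
  have hbd : CompactSpace G.boundary := isCompact_iff_compactSpace.1 isClosed_boundary.isCompact
  have h1 : IsCompact (Subtype.val '' Ω) := hΩ.1.isCompact.image continuous_subtype_val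
  have h2 : IsCompact (Subtype.val '' Ωᶜ) :=
    hΩ.compl.1.isCompact.image continuous_subtype_val
  obtain ⟨A, hA, hfin, hcar, hsub, hdis⟩ := exists_isOpen_finite_frontier hweak h1 h2
    ((disjoint_image_iff Subtype.val_injective).2 disjoint_compl_right)
  set ψ : V → ℝ := fun v => if ∃ x : G.Point, x.IsVertex v ∧ (x : G.Compl) ∈ A then 1 else 0 with hψ
  have hψ1 : ∀ (v : V) (x : G.Point), x.IsVertex v → ψ v = if (x : G.Compl) ∈ A then 1 else 0 := by
    intro v x hx
    simp only [hψ]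
    refine if_congr ⟨?_, fun h => ⟨x, hx, h⟩⟩ rfl rfl
    rintro ⟨y, hy, hyA⟩
    rwa [coe_eq_of_isVertex hx hy]
  have hS : {e : G.Edge | ψ (G.src e) ≠ ψ (G.tgt e)}.Finite := by
    have : (⋃ w ∈ frontier A, {e : G.Edge | ∃ y : G.Point, y.edge = e ∧ (y : G.Compl) = w}).Finite := by
      refine hfin.biUnion fun w hw => ?_
      obtain ⟨x, rfl⟩ := hcar hw
      exact finite_edges_through x
    refine this.subset fun e he => ?_
    rw [mem_ofPred_eq, hψ1 _ _ (G.isVertex_mk_zero e), hψ1 _ _ (G.isVertex_mk_len e), ← pt_eq,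
      ← pt_eq] at he
    have hpre : IsPreconnected (G.pt e '' Icc 0 (G.len e)) :=
      isPreconnected_Icc.image _ (G.continuous_pt e).continuousOn
    have h0 : G.pt e 0 ∈ G.pt e '' Icc 0 (G.len e) := ⟨0, ⟨le_rfl, (G.len_pos e).le⟩, rfl⟩
    have hl : G.pt e (G.len e) ∈ G.pt e '' Icc 0 (G.len e) :=
      ⟨G.len e, ⟨(G.len_pos e).le, le_rfl⟩, rfl⟩
    have hmeet : ∃ w ∈ G.pt e '' Icc 0 (G.len e), w ∈ frontier A := by
      by_contra hno
      push Not at hno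
      have hcov : G.pt e '' Icc 0 (G.len e) ⊆ A ∪ (closure A)ᶜ := by
        intro w hw
        by_cases hwc : w ∈ closure A
        · left
          by_contra hwA
          exact hno w hw (by rw [hA.frontier_eq]; exact ⟨hwc, hwA⟩)
        · exact Or.inr hwc
      have hdisj : ∀ w, w ∈ (closure A)ᶜ → w ∉ A := fun w hw hwA => hw (subset_closure hwA)
      have hc := hpre A (closure A)ᶜ hA isClosed_closure.isOpen_compl hcov
      by_cases h0A : G.pt e 0 ∈ A
      · have hlA : G.pt e (G.len e) ∉ A := fun h => he (by rw [if_pos h0A, if_pos h])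
        obtain ⟨w, -, hw1, hw2⟩ := hc ⟨_, h0, h0A⟩ ⟨_, hl, (hcov hl).resolve_left hlA⟩
        exact hdisj w hw2 hw1
      · have hlA : G.pt e (G.len e) ∈ A := by
          by_contra h
          exact he (by rw [if_neg h0A, if_neg h])
        obtain ⟨w, -, hw1, hw2⟩ := hc ⟨_, hl, hlA⟩ ⟨_, h0, (hcov h0).resolve_left h0A⟩
        exact hdisj w hw2 hw1
    obtain ⟨_, ⟨t, ht, rfl⟩, hw⟩ := hmeet
    exact mem_biUnion hw ⟨_, rfl, (G.pt_eq ht).symm⟩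
  obtain ⟨φ, hφ, hφv⟩ := exists_isEventuallyFlat hS
  have hval : ∀ z ∈ G.vertexSet, φ z = if z ∈ A then 1 else 0 := by
    rintro _ ⟨v, x, hx, rfl⟩
    rw [hφv v x hx, hψ1 v x hx]
  -- A boundary point in an open set is a limit of vertices in that set, so `φ` inherits their
  -- common value.
  have hconst : ∀ (c : ℝ) (B : Set G.Compl), IsOpen B → (∀ z ∈ B ∩ G.vertexSet, φ z = c) →
      ∀ z ∈ B, z ∈ G.boundary → φ z = c := by
    intro c B hB hBc z hz hzb
    have h3 : z ∈ closure (B ∩ G.vertexSet) := hB.inter_closure ⟨hz, boundary_subset_closure hzb⟩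
    exact closure_minimal (t := {z | φ z = c}) hBc (isClosed_eq hφ.continuous continuous_const) h3
  refine ⟨φ, hφ, fun z hz => ?_, fun z hz => ?_⟩
  · refine hconst 1 A hA (fun w hw => ?_) z (hsub ⟨z, hz, rfl⟩) z.2
    rw [hval w hw.2, if_pos hw.1]
  · have hzc : (z : G.Compl) ∉ closure A := fun h => disjoint_left.1 hdis h ⟨z, hz, rfl⟩
    refine hconst 0 (closure A)ᶜ isClosed_closure.isOpen_compl (fun w hw => ?_) z hzc z.2
    rw [hval w hw.2, if_neg fun h => hw.1 (subset_closure h)]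

end MetricGraph

/-! ### The maximum principle and uniqueness of the extension. -/

namespace MetricGraph

variable {V : Type*} {G : MetricGraph V} {q : G.Edge → ℝ → ℝ} {u v : G.Compl → ℝ}

theorem IsQHarmonic.exists_isSol (h : G.IsQHarmonic q u) (e : G.Edge) :
    ∃ w, IsSol (G.len e) (q e) (G.onEdge u e) w := by
  obtain ⟨w, h1, h2, h3⟩ := h.equation e
  exact ⟨w, h1, h2, h3⟩

open Classical in
theorem vertexDeriv_eq {e : G.Edge} {w : ℝ → ℝ} (h : IsSol (G.len e) (q e) (G.onEdge u e) w)
    (a : V) : G.vertexDeriv u a e = if G.src e = a then w 0 else -w (G.len e) := by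
  have hu := uniqueDiffOn_Icc (G.len_pos e)
  have h0 : (0 : ℝ) ∈ Icc 0 (G.len e) := left_mem_Icc.2 (G.len_pos e).le
  have h1 : G.len e ∈ Icc 0 (G.len e) := right_mem_Icc.2 (G.len_pos e).le
  unfold vertexDeriv
  rw [(h.deriv _ h0).derivWithin (hu _ h0), (h.deriv _ h1).derivWithin (hu _ h1)]

theorem IsQHarmonic.sub (hu : G.IsQHarmonic q u) (hv : G.IsQHarmonic q v) :
    G.IsQHarmonic q (fun z => u z - v z) := by
  classical
  have hsol : ∀ (e : G.Edge) (w z : ℝ → ℝ), IsSol (G.len e) (q e) (G.onEdge u e) w →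
      IsSol (G.len e) (q e) (G.onEdge v e) z →
      IsSol (G.len e) (q e) (G.onEdge (fun z => u z - v z) e) (fun t => w t + -1 * z t) := by
    intro e w z h1 h2
    refine (h1.add (h2.const_mul (-1))).congr fun t _ => ?_
    simp only [onEdge]
    ring
  refine ⟨hu.continuous.sub hv.continuous, fun e => ?_, fun a ha => ?_⟩
  · obtain ⟨w, hw⟩ := hu.exists_isSol e
    obtain ⟨z, hz⟩ := hv.exists_isSol e
    have := hsol e w z hw hz
    exact ⟨_, this.ac, this.deriv, this.eqn⟩
  · have h1 : ∀ e : G.Edge, G.vertexDeriv (fun z => u z - v z) a e =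
        G.vertexDeriv u a e - G.vertexDeriv v a e := by
      intro e
      obtain ⟨w, hw⟩ := hu.exists_isSol e
      obtain ⟨z, hz⟩ := hv.exists_isSol e
      rw [vertexDeriv_eq hw, vertexDeriv_eq hz, vertexDeriv_eq (hsol e w z hw hz)]
      split_ifs <;> ring
    simp only [h1]
    rw [finsum_mem_sub_distrib _ _ (G.finite_incident a), hu.vertex a ha, hv.vertex a ha, sub_zero]

theorem _root_.HasDerivWithinAt.nonpos_of_max_left {f : ℝ → ℝ} {c ℓ : ℝ} (hℓ : 0 < ℓ)
    (h : HasDerivWithinAt f c (Icc 0 ℓ) 0) (hmax : ∀ t ∈ Icc 0 ℓ, f t ≤ f 0) : c ≤ 0 := by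
  have h1 := IsLocalMaxOn.hasFDerivWithinAt_nonpos (f := f) (s := Icc 0 ℓ) (a := 0) (y := ℓ)
    (IsMaxOn.localize hmax) h.hasFDerivWithinAt (by
      refine mem_posTangentConeAt_of_segment_subset ?_
      rw [zero_add, segment_eq_Icc hℓ.le])
  simp only [ContinuousLinearMap.toSpanSingleton_apply, smul_eq_mul] at h1
  exact nonpos_of_mul_nonpos_right h1 hℓ

theorem _root_.HasDerivWithinAt.nonneg_of_max_right {f : ℝ → ℝ} {c ℓ : ℝ} (hℓ : 0 < ℓ)
    (h : HasDerivWithinAt f c (Icc 0 ℓ) ℓ) (hmax : ∀ t ∈ Icc 0 ℓ, f t ≤ f ℓ) : 0 ≤ c := by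
  have h1 := IsLocalMaxOn.hasFDerivWithinAt_nonpos (f := f) (s := Icc 0 ℓ) (a := ℓ) (y := -ℓ)
    (IsMaxOn.localize hmax) h.hasFDerivWithinAt (by
      refine mem_posTangentConeAt_of_segment_subset ?_
      rw [add_neg_cancel, segment_symm, segment_eq_Icc hℓ.le])
  simp only [ContinuousLinearMap.toSpanSingleton_apply, smul_eq_mul] at h1
  nlinarith

/-- The maximum principle. -/
theorem IsQHarmonic.nonpos (hcompact : CompactSpace G.Compl)
    (hq : ∀ e, ∀ t ∈ Ioo 0 (G.len e), 0 ≤ q e t) (hne : G.boundary.Nonempty)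
    (h : G.IsQHarmonic q u) (hu : ∀ z ∈ G.boundary, u z ≤ 0) (z : G.Compl) : u z ≤ 0 := by
  classical
  obtain ⟨z₀, -, hz₀⟩ := isCompact_univ.exists_isMaxOn ⟨z, mem_univ z⟩
    h.continuous.continuousOn
  have hmax : ∀ z, u z ≤ u z₀ := fun z => hz₀ (mem_univ z)
  by_contra hpos
  push Not at hpos
  set M := u z₀ with hM
  have hM0 : 0 < M := hpos.trans_le (hmax z)
  have hmaxe : ∀ e t, G.onEdge u e t ≤ M := fun e t => hmax _
  have hcrit : ∀ (e : G.Edge) (w : ℝ → ℝ) (t : ℝ), IsSol (G.len e) (q e) (G.onEdge u e) w →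
      t ∈ Icc 0 (G.len e) → G.onEdge u e t = M → w t = 0 →
      ∀ t ∈ Icc 0 (G.len e), G.onEdge u e t = M := fun e w t hw ht h1 h2 =>
    hw.eq_of_max (hq e) hM0 (fun t _ => hmaxe e t) ht h1 h2
  -- A vertex carrying a positive maximum is not a boundary vertex. The derivatives into its edges
  -- are all nonpositive and sum to zero, so each vanishes and the strong maximum principle applies
  -- on every incident edge.
  have hvert : ∀ (a : V) (x : G.Point), x.IsVertex a → u x = M →
      ∀ e : G.Edge, a ∈ (e : Sym2 V) → ∀ t ∈ Icc 0 (G.len e), G.onEdge u e t = M := by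
    intro a x hx hxM
    have hdeg : 2 ≤ (G.graph.neighborSet a).ncard := by
      by_contra hlt
      have hn : (G.graph.neighborSet a).Nonempty := by
        have hadj := x.edge.2
        rw [← G.ends, SimpleGraph.mem_edgeSet] at hadj
        rcases hx with ⟨-, rfl⟩ | ⟨-, rfl⟩
        · exact ⟨_, hadj⟩
        · exact ⟨_, hadj.symm⟩
      have h1 := (ncard_pos (G.locallyFinite a)).2 hn
      have h2 := hu x (Or.inl ⟨a, x, by omega, hx, rfl⟩)
      linarith
    choose w hw using h.exists_isSol
    have h0 : ∀ e, G.src e = a → G.onEdge u e 0 = M := by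
      intro e he
      rw [onEdge, pt_eq G (left_mem_Icc.2 (G.len_pos e).le), ← hxM,
        coe_eq_of_isVertex (he ▸ G.isVertex_mk_zero e) hx]
    have hl : ∀ e, G.tgt e = a → G.onEdge u e (G.len e) = M := by
      intro e he
      rw [onEdge, pt_eq G (right_mem_Icc.2 (G.len_pos e).le), ← hxM,
        coe_eq_of_isVertex (he ▸ G.isVertex_mk_len e) hx]
    have hnonpos : ∀ e ∈ (G.finite_incident a).toFinset, G.vertexDeriv u a e ≤ 0 := by
      intro e he
      rw [vertexDeriv_eq (hw e)]
      rw [Finite.mem_toFinset, mem_ofPred_eq, mem_edge_iff] at he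
      split_ifs with hs
      · exact ((hw e).deriv 0 (left_mem_Icc.2 (G.len_pos e).le)).nonpos_of_max_left (G.len_pos e)
          fun t _ => by rw [h0 e hs]; exact hmaxe e t
      · have := ((hw e).deriv _ (right_mem_Icc.2 (G.len_pos e).le)).nonneg_of_max_right (G.len_pos e)
          fun t _ => by rw [hl e (he.resolve_left hs)]; exact hmaxe e t
        linarith
    have hsum := h.vertex a hdeg
    rw [finsum_mem_eq_finite_toFinset_sum _ (G.finite_incident a),
      Finset.sum_eq_zero_iff_of_nonpos hnonpos] at hsum
    intro e he
    have hve := hsum e ((G.finite_incident a).mem_toFinset.2 he)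
    rw [vertexDeriv_eq (hw e)] at hve
    rw [mem_edge_iff] at he
    split_ifs at hve with hs
    · exact hcrit e (w e) 0 (hw e) (left_mem_Icc.2 (G.len_pos e).le) (h0 e hs) hve
    · exact hcrit e (w e) _ (hw e) (right_mem_Icc.2 (G.len_pos e).le) (hl e (he.resolve_left hs))
        (neg_eq_zero.1 hve)
  have hstart : ∃ e : G.Edge, ∀ t ∈ Icc 0 (G.len e), G.onEdge u e t = M := by
    have hz : z₀ ∈ G.carrier := by
      by_contra hz
      linarith [hu z₀ (Or.inr hz)]
    obtain ⟨x, rfl⟩ := hz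
    refine ⟨x.edge, ?_⟩
    by_cases hx : ∃ a, x.IsVertex a
    · obtain ⟨a, ha⟩ := hx
      refine hvert a x ha rfl x.edge (G.mem_edge_iff.2 ?_)
      exact ha.imp And.right And.right
    · push Not at hx
      obtain ⟨w, hw⟩ := h.exists_isSol x.edge
      have hmem : x.pos ∈ Ioo 0 (G.len x.edge) := by
        have := edgeTent_pos hx
        rw [edgeTent, if_pos rfl, lt_min_iff, sub_pos] at this
        exact this
      have hval : G.onEdge u x.edge x.pos = M := by rw [onEdge, pt_pos]
      refine hcrit x.edge w x.pos hw (Ioo_subset_Icc_self hmem) hval ?_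
      refine IsLocalMax.hasDerivAt_eq_zero ?_ (hw.hasDerivAt hmem)
      exact Eventually.of_forall fun t => by rw [hval]; exact hmaxe _ t
  obtain ⟨e₀, he₀⟩ := hstart
  have hedge : ∀ e : G.Edge, (∀ t ∈ Icc 0 (G.len e), G.onEdge u e t = M) → ∀ a ∈ (e : Sym2 V),
      ∀ e' : G.Edge, a ∈ (e' : Sym2 V) → ∀ t ∈ Icc 0 (G.len e'), G.onEdge u e' t = M := by
    intro e he a ha
    rcases G.mem_edge_iff.1 ha with rfl | rfl
    · refine hvert _ _ (G.isVertex_mk_zero e) ?_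
      rw [← pt_eq]
      exact he 0 (left_mem_Icc.2 (G.len_pos e).le)
    · refine hvert _ _ (G.isVertex_mk_len e) ?_
      rw [← pt_eq]
      exact he _ (right_mem_Icc.2 (G.len_pos e).le)
  have hwalk : ∀ (a b : V) (p : G.graph.Walk a b),
      (∀ e : G.Edge, a ∈ (e : Sym2 V) → ∀ t ∈ Icc 0 (G.len e), G.onEdge u e t = M) →
      ∀ e : G.Edge, b ∈ (e : Sym2 V) → ∀ t ∈ Icc 0 (G.len e), G.onEdge u e t = M := by
    intro a b p
    induction p with
    | nil => exact id
    | @cons a c b hac p ih =>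
      intro ha
      refine ih ?_
      exact hedge ⟨s(a, c), hac⟩ (ha ⟨s(a, c), hac⟩ (Sym2.mem_mk_left a c)) c (Sym2.mem_mk_right a c)
  have hall : ∀ e : G.Edge, ∀ t ∈ Icc 0 (G.len e), G.onEdge u e t = M := by
    intro e
    obtain ⟨p⟩ := G.connected.preconnected (G.src e₀) (G.src e)
    exact hwalk _ _ p (hedge e₀ he₀ _ (G.mem_edge_iff.2 (Or.inl rfl))) e
      (G.mem_edge_iff.2 (Or.inl rfl))
  -- By density `u` equals `M > 0` on the whole completion, which any single boundary point
  -- contradicts.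
  obtain ⟨y, hy⟩ := hne
  have hyM : u y = M := by
    refine closure_minimal (s := G.carrier) (t := {z | u z = M}) ?_
      (isClosed_eq h.continuous continuous_const) (G.dense_carrier y)
    rintro _ ⟨x, rfl⟩
    have := hall x.edge x.pos ⟨x.nonneg, x.le_len⟩
    rwa [onEdge, pt_pos] at this
  linarith [hu y hy]

theorem IsExtension.unique (hcompact : CompactSpace G.Compl)
    (hq : ∀ e, ∀ t ∈ Ioo 0 (G.len e), 0 ≤ q e t) (hne : G.boundary.Nonempty)
    {U : G.boundary → ℝ} (hu : G.IsExtension q U u) (hv : G.IsExtension q U v) : u = v := by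
  ext z
  refine le_antisymm ?_ ?_
  · have := (hu.1.sub hv.1).nonpos hcompact hq hne (fun z hz => by
      rw [hu.2 ⟨z, hz⟩, hv.2 ⟨z, hz⟩, sub_self]) z
    linarith
  · have := (hv.1.sub hu.1).nonpos hcompact hq hne (fun z hz => by
      rw [hu.2 ⟨z, hz⟩, hv.2 ⟨z, hz⟩, sub_self]) z
    linarith

end MetricGraph

/-! ### The energy space and the closure of the finitely supported functions. -/

namespace MetricGraph

variable {V : Type*}

/-- On each edge, the basis `a, b` of the solutions of `u'' = q u` with boundary values `(1, 0)` and
`(0, 1)`, and the coefficients that write the Dirichlet-Neumann form of the edge as a sum of two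
squares. -/
structure SolBasis (G : MetricGraph V) (q : G.Edge → ℝ → ℝ) where
  a : G.Edge → ℝ → ℝ
  a' : G.Edge → ℝ → ℝ
  b : G.Edge → ℝ → ℝ
  b' : G.Edge → ℝ → ℝ
  x : G.Edge → ℝ
  y : G.Edge → ℝ
  z : G.Edge → ℝ
  sol_a : ∀ e, IsSol (G.len e) (q e) (a e) (a' e)
  sol_b : ∀ e, IsSol (G.len e) (q e) (b e) (b' e)
  a_zero : ∀ e, a e 0 = 1
  a_len : ∀ e, a e (G.len e) = 0
  b_zero : ∀ e, b e 0 = 0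
  b_len : ∀ e, b e (G.len e) = 1
  a'_zero : ∀ e, -a' e 0 = x e * x e
  b'_zero : ∀ e, -b' e 0 = x e * y e
  a'_len : ∀ e, a' e (G.len e) = x e * y e
  b'_len : ∀ e, b' e (G.len e) = y e * y e + z e * z e

variable {G : MetricGraph V} {q : G.Edge → ℝ → ℝ}

theorem nonempty_solBasis (hq : ∀ e, IntegrableOn (q e) (Ioo 0 (G.len e)))
    (hq0 : ∀ e, ∀ t ∈ Ioo 0 (G.len e), 0 ≤ q e t) : Nonempty (SolBasis G q) := by
  choose a a' b b' x y z h1 h2 h3 h4 h5 h6 h7 h8 h9 h10 using fun e =>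
    exists_isSol_basis (G.len_pos e) (hq e) (hq0 e)
  exact ⟨⟨a, a', b, b', x, y, z, h1, h2, h3, h4, h5, h6, h7, h8, h9, h10⟩⟩

variable (G) in
/-- The Hilbert space in which the vertex functions of finite energy are embedded. -/
abbrev EnergySpace : Type _ := lp (fun _ : G.Edge => EuclideanSpace ℝ (Fin 2)) 2

variable (G) in
/-- The finitely supported functions on the vertices that vanish at the boundary vertices. -/
def finSupp : Submodule ℝ (V → ℝ) where
  carrier := {g | g.support.Finite ∧ ∀ v, (G.graph.neighborSet v).ncard = 1 → g v = 0}
  add_mem' := by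
    rintro f g ⟨h1, h2⟩ ⟨h3, h4⟩
    exact ⟨(h1.union h3).subset (Function.support_add f g), fun v hv => by
      rw [Pi.add_apply, h2 v hv, h4 v hv, add_zero]⟩
  zero_mem' := ⟨by simp, fun _ _ => rfl⟩
  smul_mem' := by
    rintro c f ⟨h1, h2⟩
    exact ⟨h1.subset (Function.support_const_smul_subset c f), fun v hv => by
      rw [Pi.smul_apply, h2 v hv, smul_zero]⟩

theorem EnergySpace.norm_sq_eq (h : G.EnergySpace) : HasSum (fun e => ‖h e‖ ^ 2) (‖h‖ ^ 2) := by
  have := lp.hasSum_inner (𝕜 := ℝ) h h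
  simpa only [real_inner_self_eq_norm_sq] using this

namespace SolBasis

variable (B : SolBasis G q)

/-- The solution on the edge `e` with the values of `f` at its endpoints. -/
def interp (f : V → ℝ) (e : G.Edge) (t : ℝ) : ℝ := f (G.src e) * B.a e t + f (G.tgt e) * B.b e t

/-- The derivative of `interp`. -/
def interp' (f : V → ℝ) (e : G.Edge) (t : ℝ) : ℝ := f (G.src e) * B.a' e t + f (G.tgt e) * B.b' e t

/-- The components of the sum of squares of the Dirichlet-Neumann form. -/
def emb (f : V → ℝ) (e : G.Edge) : EuclideanSpace ℝ (Fin 2) :=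
  !₂[B.x e * f (G.src e) + B.y e * f (G.tgt e), B.z e * f (G.tgt e)]

theorem isSol_interp (f : V → ℝ) (e : G.Edge) :
    IsSol (G.len e) (q e) (B.interp f e) (B.interp' f e) :=
  ((B.sol_a e).const_mul _).add ((B.sol_b e).const_mul _)

theorem interp_zero (f : V → ℝ) (e : G.Edge) : B.interp f e 0 = f (G.src e) := by
  simp [interp, B.a_zero, B.b_zero]

theorem interp_len (f : V → ℝ) (e : G.Edge) : B.interp f e (G.len e) = f (G.tgt e) := by
  simp [interp, B.a_len, B.b_len]

theorem interp_of_isVertex (f : V → ℝ) {v : V} {x : G.Point} (hx : x.IsVertex v) :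
    B.interp f x.edge x.pos = f v := by
  rcases hx with ⟨h, rfl⟩ | ⟨h, rfl⟩
  · rw [h, interp_zero]
  · rw [h, interp_len]

/-- This is the purpose of the coefficients `x, y, z`: the Euclidean inner product reproduces the
boundary form in Green's formula. -/
theorem inner_emb (f g : V → ℝ) (e : G.Edge) : inner ℝ (B.emb f e) (B.emb g e) =
    B.interp' f e (G.len e) * g (G.tgt e) - B.interp' f e 0 * g (G.src e) := by
  have h1 : B.a' e 0 = -(B.x e * B.x e) := by linarith [B.a'_zero e]
  have h2 : B.b' e 0 = -(B.x e * B.y e) := by linarith [B.b'_zero e]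
  simp only [emb, PiLp.inner_apply, Fin.sum_univ_two, interp', h1, h2, B.a'_len, B.b'_len]
  simp
  ring

theorem norm_sq_emb (f : V → ℝ) (e : G.Edge) : ‖B.emb f e‖ ^ 2 =
    B.interp' f e (G.len e) * B.interp f e (G.len e) - B.interp' f e 0 * B.interp f e 0 := by
  rw [← real_inner_self_eq_norm_sq, inner_emb, interp_zero, interp_len]

theorem emb_sub (f g : V → ℝ) (e : G.Edge) : B.emb (f - g) e = B.emb f e - B.emb g e := by
  ext i
  fin_cases i <;> simp [emb] <;> ring

theorem emb_eq_zero {f : V → ℝ} {e : G.Edge} (h1 : f (G.src e) = 0) (h2 : f (G.tgt e) = 0) :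
    B.emb f e = 0 := by
  ext i
  fin_cases i <;> simp [emb, h1, h2]

theorem memℓp_emb_finSupp {g : V → ℝ} (hg : g.support.Finite) : Memℓp (B.emb g) 2 := by
  refine memℓp_gen (summable_of_hasFiniteSupport ?_)
  have hfin : (⋃ v ∈ g.support, {e : G.Edge | v ∈ (e : Sym2 V)}).Finite :=
    hg.biUnion fun v _ => G.finite_incident v
  refine hfin.subset fun e he => ?_
  by_contra hno
  refine he ?_
  simp only [mem_iUnion, not_exists] at hno
  have h1 : g (G.src e) = 0 := by
    by_contra h
    exact hno _ h (G.mem_edge_iff.2 (Or.inl rfl))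
  have h2 : g (G.tgt e) = 0 := by
    by_contra h
    exact hno _ h (G.mem_edge_iff.2 (Or.inr rfl))
  simp [B.emb_eq_zero h1 h2]

/-- The embedding of the finitely supported functions in the energy space. -/
noncomputable def embFinSupp : G.finSupp →ₗ[ℝ] G.EnergySpace where
  toFun g := ⟨B.emb g, B.memℓp_emb_finSupp g.2.1⟩
  map_add' f g := by
    ext e i
    change B.emb (f + g) e i = B.emb f e i + B.emb g e i
    fin_cases i <;> simp [emb] <;> ring
  map_smul' c f := by
    ext e i
    change B.emb (c • f) e i = c * B.emb f e i
    fin_cases i <;> simp [emb] <;> ring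

theorem embFinSupp_apply (g : G.finSupp) (e : G.Edge) : B.embFinSupp g e = B.emb g e := rfl

/-- The closure of the finitely supported functions in the energy space. -/
noncomputable def zeroSpace : Submodule ℝ G.EnergySpace := (LinearMap.range B.embFinSupp).topologicalClosure

theorem sq_sub_interp_le [Countable V] (hq0 : ∀ e, ∀ t ∈ Ioo 0 (G.len e), 0 ≤ q e t) {f : V → ℝ}
    {h : G.EnergySpace} (hf : ∀ e, h e = B.emb f e) (x y : G.Point) :
    (B.interp f x.edge x.pos - B.interp f y.edge y.pos) ^ 2 ≤ ‖h‖ ^ 2 * dist x y := by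
  have hs := EnergySpace.norm_sq_eq h
  rw [← hs.tsum_eq]
  refine sq_sub_le_energy_mul_dist (W := B.interp' f) (fun e => (B.isSol_interp f e).deriv)
    (fun e => ?_) (fun e => ?_) hs.summable (fun v x y hx hy => ?_) x y
  · have := (B.isSol_interp f e).ac.continuousOn
    rwa [uIcc_of_le (G.len_pos e).le] at this
  · rw [hf, norm_sq_emb]
    exact (B.isSol_interp f e).integral_sq_le (G.len_pos e).le (hq0 e)
  · rw [B.interp_of_isVertex f hx, B.interp_of_isVertex f hy]

/-- A vertex function of finite energy extends to the completion. -/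
theorem exists_extend [Countable V] (hq0 : ∀ e, ∀ t ∈ Ioo 0 (G.len e), 0 ≤ q e t) {f : V → ℝ}
    {h : G.EnergySpace} (hf : ∀ e, h e = B.emb f e) :
    ∃ u : G.Compl → ℝ, Continuous u ∧ (∀ x : G.Point, u x = B.interp f x.edge x.pos) ∧
      ∀ x y, (u x - u y) ^ 2 ≤ ‖h‖ ^ 2 * dist x y := by
  have hH := B.sq_sub_interp_le hq0 hf
  have huc : UniformContinuous fun x : G.Point => B.interp f x.edge x.pos := by
    rw [Metric.uniformContinuous_iff]
    intro ε hε
    refine ⟨ε ^ 2 / (‖h‖ ^ 2 + 1), by positivity, fun x y hxy => ?_⟩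
    rw [lt_div_iff₀ (by positivity)] at hxy
    rw [Real.dist_eq]
    refine abs_lt_of_sq_lt_sq ?_ hε.le
    have := hH x y
    nlinarith [dist_nonneg (x := x) (y := y)]
  refine ⟨UniformSpace.Completion.extension fun x : G.Point => B.interp f x.edge x.pos,
    UniformSpace.Completion.continuous_extension,
    fun x => UniformSpace.Completion.extension_coe huc x, fun x y => ?_⟩
  have hc := UniformSpace.Completion.continuous_extension
    (f := fun x : G.Point => B.interp f x.edge x.pos)
  refine UniformSpace.Completion.induction_on₂ x y (isClosed_le ?_ ?_) fun x y => ?_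
  · exact ((hc.comp continuous_fst).sub (hc.comp continuous_snd)).pow 2
  · exact continuous_const.mul continuous_dist
  · rw [UniformSpace.Completion.extension_coe huc, UniformSpace.Completion.extension_coe huc,
      UniformSpace.Completion.dist_eq]
    exact hH x y

/-- The extension of `g` is zero at `z`: either `z` is a boundary vertex, or it is a limit of
vertices outside the finite support. The Hölder bound then applies, with a constant depending only
on the energy, so the estimate passes to limits. -/
theorem sq_le_of_finSupp [Countable V] (hq0 : ∀ e, ∀ t ∈ Ioo 0 (G.len e), 0 ≤ q e t)
    (g : G.finSupp) {v : V} {x : G.Point} (hx : x.IsVertex v) {z : G.Compl} (hz : z ∈ G.boundary) :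
    (g : V → ℝ) v ^ 2 ≤ ‖B.embFinSupp g‖ ^ 2 * dist (x : G.Compl) z := by
  obtain ⟨u, hu, hux, hH⟩ := B.exists_extend hq0 (f := g) (h := B.embFinSupp g)
    (B.embFinSupp_apply g)
  have huz : u z = 0 := by
    rcases hz with ⟨w, y, hw, hy, rfl⟩ | hz
    · rw [hux, B.interp_of_isVertex _ hy, g.2.2 w hw]
    · set T : Set G.Compl := ⋃ w ∈ (g : V → ℝ).support,
        {p | ∃ y : G.Point, y.IsVertex w ∧ p = y} with hT
      have hTfin : T.Finite := by
        refine g.2.1.biUnion fun w _ => Set.Subsingleton.finite ?_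
        rintro _ ⟨y, hy, rfl⟩ _ ⟨y', hy', rfl⟩
        exact coe_eq_of_isVertex hy hy'
      have hzT : z ∈ Tᶜ := by
        intro h
        simp only [hT, mem_iUnion] at h
        obtain ⟨w, -, y, -, rfl⟩ := h
        exact hz ⟨y, rfl⟩
      have h1 : z ∈ closure (Tᶜ ∩ G.vertexSet) :=
        hTfin.isClosed.isOpen_compl.inter_closure ⟨hzT, mem_closure_vertexSet hz⟩
      refine closure_minimal (t := {p | u p = 0}) ?_ (isClosed_eq hu continuous_const) h1
      rintro _ ⟨hpT, w, y, hy, rfl⟩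
      rw [mem_ofPred_eq, hux, B.interp_of_isVertex _ hy]
      by_contra hne
      exact hpT (mem_biUnion (x := w) hne ⟨y, hy, rfl⟩)
  have := hH x z
  rwa [huz, sub_zero, hux, B.interp_of_isVertex _ hx] at this

/-- The elements of the closure of the finitely supported functions are vertex functions that
vanish on the boundary. -/
theorem exists_of_mem_zeroSpace [Countable V] (hq0 : ∀ e, ∀ t ∈ Ioo 0 (G.len e), 0 ≤ q e t)
    (hne : G.boundary.Nonempty) {p : G.EnergySpace} (hp : p ∈ B.zeroSpace) :
    ∃ g : V → ℝ, (∀ e, p e = B.emb g e) ∧ ∀ (v : V) (x : G.Point), x.IsVertex v →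
      ∀ z ∈ G.boundary, g v ^ 2 ≤ ‖p‖ ^ 2 * dist (x : G.Compl) z := by
  obtain ⟨z₀, hz₀⟩ := hne
  have hp' : p ∈ closure (LinearMap.range B.embFinSupp : Set G.EnergySpace) := hp
  obtain ⟨s, hs, hlim⟩ := mem_closure_iff_seq_limit.1 hp'
  choose γ hγ using hs
  -- Comparison with one boundary point `z₀` makes evaluation at a vertex continuous for the energy
  -- norm.
  have hcauchy : ∀ (v : V) (x : G.Point), x.IsVertex v →
      CauchySeq fun n => (γ n : V → ℝ) v := by
    intro v x hx
    rw [Metric.cauchySeq_iff']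
    intro ε hε
    set d := dist (x : G.Compl) z₀ with hd
    have hd0 : 0 ≤ d := dist_nonneg
    obtain ⟨N, hN⟩ := Metric.cauchySeq_iff'.1 hlim.cauchySeq (ε / (d + 1)) (by positivity)
    refine ⟨N, fun n hn => ?_⟩
    have h1 := B.sq_le_of_finSupp hq0 (γ n - γ N) hx hz₀
    have h2 := hN n hn
    rw [map_sub, hγ, hγ, ← dist_eq_norm] at h1
    rw [lt_div_iff₀ (by positivity)] at h2
    rw [Real.dist_eq]
    refine abs_lt_of_sq_lt_sq ?_ hε.le
    have h3 : ((γ n - γ N : G.finSupp) : V → ℝ) v = (γ n : V → ℝ) v - (γ N : V → ℝ) v := rfl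
    rw [h3] at h1
    have h4 : (dist (s n) (s N) * (d + 1)) ^ 2 < ε ^ 2 := by
      gcongr
    have h5 : dist (s n) (s N) ^ 2 * d ≤ (dist (s n) (s N) * (d + 1)) ^ 2 := by
      rw [mul_pow]
      refine mul_le_mul_of_nonneg_left ?_ (sq_nonneg _)
      nlinarith
    exact (h1.trans h5).trans_lt h4
  set g : V → ℝ := fun v => limUnder atTop fun n => (γ n : V → ℝ) v with hg
  have hglim : ∀ (v : V) (x : G.Point), x.IsVertex v →
      Tendsto (fun n => (γ n : V → ℝ) v) atTop (𝓝 (g v)) := fun v x hx =>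
    CauchySeq.tendsto_limUnder (hcauchy v x hx)
  refine ⟨g, fun e => ?_, fun v x hx z hz => ?_⟩
  · have h0 := hglim _ _ (G.isVertex_mk_zero e)
    have hl := hglim _ _ (G.isVertex_mk_len e)
    have hp1 : Tendsto (fun n => s n e) atTop (𝓝 (p e)) := by
      rw [tendsto_iff_dist_tendsto_zero] at hlim ⊢
      refine squeeze_zero (fun _ => dist_nonneg) (fun n => ?_) hlim
      rw [dist_eq_norm, dist_eq_norm]
      exact lp.norm_apply_le_norm two_ne_zero (s n - p) e
    have hp2 : ∀ i : Fin 2, Tendsto (fun n => s n e i) atTop (𝓝 (p e i)) := fun i =>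
      ((PiLp.continuous_apply 2 _ i).tendsto _).comp hp1
    ext i
    refine tendsto_nhds_unique (hp2 i) ?_
    simp only [← hγ, embFinSupp_apply]
    fin_cases i
    · simpa [emb] using (h0.const_mul (B.x e)).add (hl.const_mul (B.y e))
    · simpa [emb] using hl.const_mul (B.z e)
  · refine le_of_tendsto_of_tendsto' ((hglim v x hx).pow 2)
      ((hlim.norm.pow 2).mul_const _) fun n => ?_
    have := B.sq_le_of_finSupp hq0 (γ n) hx hz
    rwa [hγ] at this

end SolBasis

end MetricGraph

/-! ### Green's formula against flat test functions. -/

/-- A function that is smooth in the interior of an interval and flat near its endpoints agrees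
with a `C²` function on the interval. -/
theorem exists_contDiff_eqOn {f : ℝ → ℝ} {ℓ ε : ℝ} (hc : ContinuousOn f (Icc 0 ℓ))
    (hf : ContDiffOn ℝ ((⊤ : ℕ∞) : WithTop ℕ∞) f (Ioo 0 ℓ)) (hε : 0 < ε)
    (hflat : ∀ t ∈ Ioo 0 ℓ, t < ε ∨ ℓ - ε < t → deriv f t = 0) :
    ∃ F D D' : ℝ → ℝ, EqOn F f (Icc 0 ℓ) ∧ (∀ t, HasDerivAt F (D t) t) ∧
      (∀ t, HasDerivAt D (D' t) t) ∧ Continuous D' ∧ D 0 = 0 ∧ D ℓ = 0 ∧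
      ∀ t ∈ Ioo 0 ℓ, deriv (deriv f) t = D' t := by
  -- Nothing is known about `f` outside the interval; its derivative extended by zero is `C¹` on the
  -- line thanks to flatness, and integrates back to `f` on the interval.
  set D : ℝ → ℝ := (Ioo 0 ℓ).indicator (deriv f) with hD
  have hDin : ∀ t ∈ Ioo 0 ℓ, D t = deriv f t := fun t ht => indicator_of_mem ht _
  have hDzero : ∀ t, t < ε ∨ ℓ - ε < t → D t = 0 := by
    intro t ht
    by_cases h : t ∈ Ioo 0 ℓ
    · rw [hDin t h, hflat t h ht]
    · exact indicator_of_notMem h _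
  have hfd : ContDiffOn ℝ ((⊤ : ℕ∞) : WithTop ℕ∞) (deriv f) (Ioo 0 ℓ) :=
    hf.deriv_of_isOpen isOpen_Ioo (by simp)
  have hDc : ContDiff ℝ 1 D := by
    rw [contDiff_iff_contDiffAt]
    intro t
    by_cases h : t ∈ Ioo 0 ℓ
    · have h1 : ContDiffAt ℝ 1 (deriv f) t :=
        (hfd.of_le (by exact_mod_cast le_top)).contDiffAt (isOpen_Ioo.mem_nhds h)
      refine h1.congr_of_eventuallyEq ?_
      filter_upwards [isOpen_Ioo.mem_nhds h] with s hs using hDin s hs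
    · have : D =ᶠ[𝓝 t] fun _ => 0 := by
        rw [mem_Ioo, not_and_or, not_lt, not_lt] at h
        rcases h with h | h
        · filter_upwards [Iio_mem_nhds (h.trans_lt hε)] with s hs using hDzero s (Or.inl hs)
        · filter_upwards [Ioi_mem_nhds (show ℓ - ε < t by linarith)] with s hs
            using hDzero s (Or.inr hs)
      exact contDiffAt_const.congr_of_eventuallyEq this
  have hint : ∀ t ∈ Icc 0 ℓ, ∫ s in 0..t, D s = f t - f 0 := by
    intro t ht
    refine intervalIntegral.integral_eq_sub_of_hasDerivAt_of_le ht.1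
      (hc.mono (Icc_subset_Icc_right ht.2)) (fun s hs => ?_)
      (hDc.continuous.intervalIntegrable 0 t)
    have hs' : s ∈ Ioo 0 ℓ := ⟨hs.1, hs.2.trans_le ht.2⟩
    rw [hDin s hs']
    exact ((hf.contDiffAt (isOpen_Ioo.mem_nhds hs')).differentiableAt (by simp)).hasDerivAt
  refine ⟨fun t => f 0 + ∫ s in 0..t, D s, D, deriv D, fun t ht => ?_, fun t => ?_, fun t => ?_,
    hDc.continuous_deriv le_rfl, hDzero 0 (Or.inl hε), hDzero ℓ (Or.inr (by linarith)),
    fun t ht => ?_⟩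
  · simp only [hint t ht]
    ring
  · exact (hDc.continuous.integral_hasStrictDerivAt 0 t).hasDerivAt.const_add _
  · exact (hDc.differentiable (by simp) t).hasDerivAt
  · refine (Filter.EventuallyEq.deriv_eq ?_).symm
    filter_upwards [isOpen_Ioo.mem_nhds ht] with s hs using hDin s hs

/-- Green's formula for `u L f`, where `f` is flat near the endpoints. -/
theorem IsSol.integral_mul_L {q u w f : ℝ → ℝ} {ℓ ε : ℝ} (h : IsSol ℓ q u w) (hℓ : 0 < ℓ)
    (hc : ContinuousOn f (Icc 0 ℓ)) (hf : ContDiffOn ℝ ((⊤ : ℕ∞) : WithTop ℕ∞) f (Ioo 0 ℓ))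
    (hε : 0 < ε) (hflat : ∀ t ∈ Ioo 0 ℓ, t < ε ∨ ℓ - ε < t → _root_.deriv f t = 0) :
    IntegrableOn (fun t => u t * (-_root_.deriv (_root_.deriv f) t + q t * f t)) (Ioo 0 ℓ) ∧
    ∫ t in Ioo 0 ℓ, u t * (-_root_.deriv (_root_.deriv f) t + q t * f t) = w ℓ * f ℓ - w 0 * f 0 := by
  obtain ⟨F, D, D', hF, hFD, hDD', hD'c, hD0, hDℓ, hD'⟩ := exists_contDiff_eqOn hc hf hε hflat
  have hDc : Continuous D := continuous_iff_continuousAt.2 fun t => (hDD' t).continuousAt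
  have hac : ∀ g g' : ℝ → ℝ, (∀ t, HasDerivAt g (g' t) t) → Continuous g' →
      AbsolutelyContinuousOnInterval g 0 ℓ := by
    intro g g' hg hg'
    refine ContDiffOn.absolutelyContinuousOnInterval (ContDiff.contDiffOn ?_)
    rw [contDiff_one_iff_deriv]
    exact ⟨fun t => (hg t).differentiableAt, by rwa [funext fun t => (hg t).deriv]⟩
  -- The integrand is `(w F)' - (u D)'`, and `D` vanishes at both endpoints, so only `w F`
  -- contributes boundary terms.
  obtain ⟨h1, h2⟩ := h.green hℓ.le (hac F D hFD hDc) (Eventually.of_forall hFD)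
  obtain ⟨h3, h4⟩ := ((h.ac_self hℓ.le).fun_mul (hac D D' hDD' hD'c)).integral_eq_sub_of_ae hℓ.le
    (f' := fun t => w t * D t + u t * D' t) (by
      filter_upwards [h.ae_hasDerivAt] with t ht using ht.mul (hDD' t))
  have h5 := h1.sub h3
  have h6 := intervalIntegral.integral_sub h1 h3
  rw [h2, h4, hD0, hDℓ, mul_zero, mul_zero, sub_zero, sub_zero,
    hF (right_mem_Icc.2 hℓ.le), hF (left_mem_Icc.2 hℓ.le)] at h6
  have heq : EqOn (fun t => q t * u t * F t + w t * D t - (w t * D t + u t * D' t))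
      (fun t => u t * (-_root_.deriv (_root_.deriv f) t + q t * f t)) (Ioo 0 ℓ) := by
    intro t ht
    simp only
    rw [hF (Ioo_subset_Icc_self ht), hD' t ht]
    ring
  rw [intervalIntegrable_iff_integrableOn_Ioo_of_le hℓ.le] at h5
  rw [intervalIntegral.integral_of_le hℓ.le, integral_Ioc_eq_integral_Ioo] at h6
  exact ⟨h5.congr_fun heq measurableSet_Ioo, by
    rw [← h6]; exact (setIntegral_congr_fun measurableSet_Ioo heq).symm⟩

/-! ### Existence of the extension and the pairing as an inner product. -/

namespace MetricGraph

variable {V : Type*} {G : MetricGraph V} {q : G.Edge → ℝ → ℝ} {φ : G.Compl → ℝ}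

open Classical in
/-- The restriction to the vertices of a function on the completion. -/
noncomputable def trace (φ : G.Compl → ℝ) (v : V) : ℝ :=
  if h : ∃ x : G.Point, x.IsVertex v then φ h.choose else 0

theorem trace_eq (φ : G.Compl → ℝ) {v : V} {x : G.Point} (hx : x.IsVertex v) :
    trace φ v = φ x := by
  have h : ∃ x : G.Point, x.IsVertex v := ⟨x, hx⟩
  rw [trace, dif_pos h, coe_eq_of_isVertex h.choose_spec hx]

theorem trace_src (φ : G.Compl → ℝ) (e : G.Edge) : trace φ (G.src e) = G.onEdge φ e 0 := by
  rw [trace_eq φ (G.isVertex_mk_zero e), onEdge, pt_eq]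

theorem trace_tgt (φ : G.Compl → ℝ) (e : G.Edge) : trace φ (G.tgt e) = G.onEdge φ e (G.len e) := by
  rw [trace_eq φ (G.isVertex_mk_len e), onEdge, pt_eq]

theorem continuous_onEdge (hφ : Continuous φ) (e : G.Edge) : Continuous (G.onEdge φ e) :=
  hφ.comp (G.continuous_pt e)

theorem exists_bound_of_continuous (hcompact : CompactSpace G.Compl) (hφ : Continuous φ) :
    ∃ C, 0 ≤ C ∧ ∀ z, |φ z| ≤ C := by
  obtain ⟨C, hC⟩ := isCompact_univ.exists_bound_of_continuousOn hφ.continuousOn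
  exact ⟨max C 0, le_max_right _ _, fun z => (hC z (mem_univ z)).trans (le_max_left _ _)⟩

theorem IsEventuallyFlat.onEdge_eq (hφ : G.IsEventuallyFlat φ) {e : G.Edge}
    (h : ∀ t ∈ Ioo 0 (G.len e), deriv (G.onEdge φ e) t = 0) :
    G.onEdge φ e (G.len e) = G.onEdge φ e 0 := by
  obtain ⟨c, hc, heq⟩ := exists_deriv_eq_slope (G.onEdge φ e) (G.len_pos e)
    (continuous_onEdge hφ.continuous e).continuousOn ((hφ.smooth e).differentiableOn (by simp))
  rw [h c hc, sub_zero, eq_comm, div_eq_zero_iff] at heq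
  exact sub_eq_zero.1 (heq.resolve_right (G.len_pos e).ne')

theorem summable_of_le_off_finite {ι : Type*} {a b : ι → ℝ} {S : Set ι} (hS : S.Finite)
    (ha : ∀ i, 0 ≤ a i) (hb : Summable b) (h0 : ∀ i, 0 ≤ b i) (h : ∀ i ∉ S, a i ≤ b i) :
    Summable a := by
  classical
  have h1 : Summable fun i => if i ∈ S then a i else 0 :=
    summable_of_hasFiniteSupport (hS.subset fun i hi => by
      by_contra hn
      exact hi (if_neg hn))
  refine Summable.of_nonneg_of_le ha (fun i => ?_) (hb.add h1)
  by_cases hi : i ∈ S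
  · rw [if_pos hi]
    linarith [h0 i]
  · rw [if_neg hi, add_zero]
    exact h i hi

/-- Off finitely many edges `φ''` vanishes and compactness bounds the integrand by a constant times
`|q|`. -/
theorem integrableOnGraph_mulL (hcompact : CompactSpace G.Compl) (hq : G.IntegrableOnGraph q)
    {u : G.Compl → ℝ} (hu : G.IsQHarmonic q u) (hφ : G.IsEventuallyFlat φ) :
    G.IntegrableOnGraph (G.mulL q u φ) := by
  refine ⟨fun e => ?_, ?_⟩
  · obtain ⟨w, hw⟩ := hu.exists_isSol e
    obtain ⟨ε, hε, hflat⟩ := hφ.flat_near e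
    exact (hw.integral_mul_L (G.len_pos e) (continuous_onEdge hφ.continuous e).continuousOn
      (hφ.smooth e) hε hflat).1
  · obtain ⟨C, hC0, hC⟩ := exists_bound_of_continuous hcompact hu.continuous
    obtain ⟨K, hK0, hK⟩ := exists_bound_of_continuous hcompact hφ.continuous
    obtain ⟨S, hS, hoff⟩ := hφ.flat_off
    refine summable_of_le_off_finite hS (fun e => integral_nonneg fun t => abs_nonneg _)
      (hq.2.mul_left (C * K))
      (fun e => mul_nonneg (mul_nonneg hC0 hK0) (integral_nonneg fun t => abs_nonneg _))
      fun e he => ?_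
    rw [← integral_const_mul]
    refine integral_mono_of_nonneg (Eventually.of_forall fun t => abs_nonneg _)
      ((hq.1 e).abs.const_mul _) ?_
    rw [EventuallyLE, ae_restrict_iff' measurableSet_Ioo]
    refine Eventually.of_forall fun t ht => ?_
    have h2 : deriv (deriv (G.onEdge φ e)) t = 0 := by
      have : deriv (G.onEdge φ e) =ᶠ[𝓝 t] fun _ => 0 := by
        filter_upwards [isOpen_Ioo.mem_nhds ht] with s hs using hoff e he s hs
      rw [this.deriv_eq, deriv_const]
    simp only [mulL]
    rw [h2, neg_zero, zero_add, abs_mul, abs_mul]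
    have h3 : |G.onEdge u e t| ≤ C := hC _
    have h4 : |G.onEdge φ e t| ≤ K := hK _
    calc |G.onEdge u e t| * (|q e t| * |G.onEdge φ e t|) ≤ C * (|q e t| * K) := by gcongr
      _ = C * K * |q e t| := by ring

namespace SolBasis

variable (B : SolBasis G q)

/-- Off finitely many edges the endpoint values of `φ` agree, so comparison with a constant bounds
the energy of the edge by `K² ∫ q`, which is summable. -/
theorem memℓp_emb_trace (hcompact : CompactSpace G.Compl) (hq : G.IntegrableOnGraph q)
    (hq0 : ∀ e, ∀ t ∈ Ioo 0 (G.len e), 0 ≤ q e t) (hφ : G.IsEventuallyFlat φ) :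
    Memℓp (B.emb (trace φ)) 2 := by
  refine memℓp_gen ?_
  simp only [ENNReal.toReal_ofNat, Real.rpow_ofNat]
  obtain ⟨K, hK0, hK⟩ := exists_bound_of_continuous hcompact hφ.continuous
  obtain ⟨S, hS, hoff⟩ := hφ.flat_off
  refine summable_of_le_off_finite hS (fun e => sq_nonneg _) (hq.2.mul_left (K ^ 2))
    (fun e => mul_nonneg (sq_nonneg _) (integral_nonneg fun t => abs_nonneg _)) fun e he => ?_
  have hℓ := (G.len_pos e).le
  have h1 : trace φ (G.tgt e) = trace φ (G.src e) := by
    rw [trace_src, trace_tgt, hφ.onEdge_eq (hoff e he)]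
  have hqi : IntervalIntegrable (q e) volume 0 (G.len e) :=
    (intervalIntegrable_iff_integrableOn_Ioo_of_le hℓ).2 (hq.1 e)
  rw [norm_sq_emb]
  refine ((B.isSol_interp (trace φ) e).energy_le hℓ (hq0 e) hqi (B.interp_zero _ e)
    ((B.interp_len _ e).trans h1)).trans ?_
  have h2 : trace φ (G.src e) ^ 2 ≤ K ^ 2 := by
    rw [trace_src]
    exact sq_le_sq' (abs_le.1 (hK _)).1 (abs_le.1 (hK _)).2
  have h3 : ∫ t in 0..(G.len e), q e t ≤ ∫ t in Ioo 0 (G.len e), |q e t| := by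
    rw [intervalIntegral.integral_of_le hℓ, integral_Ioc_eq_integral_Ioo]
    exact integral_mono (hq.1 e) (hq.1 e).abs fun t => le_abs_self _
  exact (mul_le_mul_of_nonneg_left h3 (sq_nonneg _)).trans
    (mul_le_mul_of_nonneg_right h2 (integral_nonneg fun t => abs_nonneg _))

/-- Existence of the extension, with the orthogonal decomposition that produces it. -/
theorem exists_isExtension [Countable V] (hcompact : CompactSpace G.Compl)
    (hq : G.IntegrableOnGraph q) (hq0 : ∀ e, ∀ t ∈ Ioo 0 (G.len e), 0 ≤ q e t)
    (hne : G.boundary.Nonempty) (hφ : G.IsEventuallyFlat φ) :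
    ∃ (r p : G.EnergySpace) (f : V → ℝ) (u : G.Compl → ℝ), r ∈ B.zeroSpaceᗮ ∧ (∀ e, r e = B.emb f e) ∧
      p - r ∈ B.zeroSpace ∧ (∀ e, p e = B.emb (trace φ) e) ∧
      G.IsExtension q (fun z => φ z) u ∧ ∀ e, EqOn (G.onEdge u e) (B.interp f e) (Icc 0 (G.len e)) := by
  classical
  set p : G.EnergySpace := ⟨B.emb (trace φ), B.memℓp_emb_trace hcompact hq hq0 hφ⟩ with hp
  have hpe : ∀ e, p e = B.emb (trace φ) e := fun e => rfl
  have hclosed : IsClosed (B.zeroSpace : Set G.EnergySpace) :=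
    Submodule.isClosed_topologicalClosure _
  have : CompleteSpace B.zeroSpace := hclosed.completeSpace_coe
  -- Dirichlet's principle: `r` is the element of least energy in `p + zeroSpace`.
  obtain ⟨s, hs, r, hr, hsr⟩ := B.zeroSpace.exists_add_mem_mem_orthogonal p
  obtain ⟨g, hg, hgle⟩ := B.exists_of_mem_zeroSpace hq0 hne hs
  set f : V → ℝ := trace φ - g with hf
  have hrf : ∀ e, r e = B.emb f e := by
    intro e
    rw [hf, emb_sub, ← hg, ← hpe, hsr]
    simp
  obtain ⟨u, hu, hux, -⟩ := B.exists_extend hq0 hrf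
  have huedge : ∀ e, EqOn (G.onEdge u e) (B.interp f e) (Icc 0 (G.len e)) := by
    intro e t ht
    rw [onEdge, pt_eq G ht, hux]
    rfl
  have hsol : ∀ e, IsSol (G.len e) (q e) (G.onEdge u e) (B.interp' f e) := fun e =>
    (B.isSol_interp f e).congr (huedge e)
  refine ⟨r, p, f, u, hr, hrf, by rwa [hsr, add_sub_cancel_right], hpe, ⟨⟨hu, fun e => ?_, fun v hv => ?_⟩, fun z => ?_⟩, huedge⟩
  · exact ⟨_, (hsol e).ac, (hsol e).deriv, (hsol e).eqn⟩
  -- Up to sign, the inner product of `r` with the point mass at `v` is the sum of the derivatives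
  -- of `u` at `v`.
  · set δ : V → ℝ := Pi.single v 1 with hδ
    have hδmem : δ ∈ G.finSupp := by
      refine ⟨(finite_singleton v).subset fun w hw => ?_, fun w hw => ?_⟩
      · by_contra hne
        exact hw (Pi.single_eq_of_ne hne _)
      · refine Pi.single_eq_of_ne (fun h => ?_) _
        rw [h] at hw
        omega
    have horth : inner ℝ r (B.embFinSupp ⟨δ, hδmem⟩) = 0 := by
      rw [real_inner_comm]
      exact hr _ (Submodule.le_topologicalClosure _ (LinearMap.mem_range_self _ _))
    rw [lp.inner_eq_tsum, tsum_eq_sum (s := (G.finite_incident v).toFinset)] at horth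
    · rw [finsum_mem_eq_finite_toFinset_sum _ (G.finite_incident v), ← neg_eq_zero,
        ← Finset.sum_neg_distrib, ← horth]
      refine Finset.sum_congr rfl fun e he => ?_
      rw [Finite.mem_toFinset, mem_ofPred_eq, mem_edge_iff] at he
      rw [vertexDeriv_eq (hsol e), hrf, embFinSupp_apply, inner_emb]
      simp only [hδ, Pi.single_apply]
      have hst := G.src_ne_tgt e
      split_ifs with h1 h2 h2
      · exact absurd (h1.trans h2.symm) hst
      · ring
      · ring
      · tauto
    · intro e he
      rw [Finite.mem_toFinset, mem_ofPred_eq, mem_edge_iff, not_or] at he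
      rw [embFinSupp_apply, B.emb_eq_zero, inner_zero_right]
      · exact Pi.single_eq_of_ne he.1 _
      · exact Pi.single_eq_of_ne he.2 _
  -- At vertices `u - φ = -g`, which is bounded by the distance to `z`. The inequality is closed, so
  -- it holds at `z` itself, where the distance is zero.
  · have hcl : IsClosed {w : G.Compl | (u w - φ w) ^ 2 ≤ ‖s‖ ^ 2 * dist w (z : G.Compl)} :=
      isClosed_le ((hu.sub hφ.continuous).pow 2)
        (continuous_const.mul (continuous_id.dist continuous_const))
    have := closure_minimal (s := G.vertexSet) ?_ hcl (boundary_subset_closure z.2)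
    · rw [mem_ofPred_eq, dist_self, mul_zero] at this
      have h0 := pow_eq_zero_iff two_ne_zero |>.1 (le_antisymm this (sq_nonneg _))
      exact sub_eq_zero.1 h0
    · rintro _ ⟨v, x, hx, rfl⟩
      have h1 := hgle v x hx z z.2
      rw [mem_ofPred_eq, hux, B.interp_of_isVertex _ hx, ← trace_eq φ hx]
      simpa [hf] using h1

/-- The Dirichlet-Neumann pairing as an inner product. -/
theorem graphIntegral_mulL {f : V → ℝ} {r p : G.EnergySpace} (hr : ∀ e, r e = B.emb f e)
    {u : G.Compl → ℝ} (hu : ∀ e, EqOn (G.onEdge u e) (B.interp f e) (Icc 0 (G.len e)))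
    (hφ : G.IsEventuallyFlat φ) (hp : ∀ e, p e = B.emb (trace φ) e) :
    G.graphIntegral (G.mulL q u φ) = inner ℝ r p := by
  rw [graphIntegral, lp.inner_eq_tsum]
  refine tsum_congr fun e => ?_
  obtain ⟨ε, hε, hflat⟩ := hφ.flat_near e
  rw [hr, hp, inner_emb, trace_src, trace_tgt]
  exact (((B.isSol_interp f e).congr (hu e)).integral_mul_L (G.len_pos e)
    (continuous_onEdge hφ.continuous e).continuousOn (hφ.smooth e) hε hflat).2

/-- The Dirichlet-Neumann function is given by the inner product of the extensions in the energy
space. -/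
theorem isDNValue_inner [Countable V] (hcompact : CompactSpace G.Compl)
    (hq : G.IntegrableOnGraph q) (hq0 : ∀ e, ∀ t ∈ Ioo 0 (G.len e), 0 ≤ q e t)
    (hne : G.boundary.Nonempty) {Ω₁ Ω₂ : Set G.boundary} {r₁ r₂ : G.EnergySpace} {f₁ f₂ : V → ℝ}
    {u₁ u₂ φ₂ : G.Compl → ℝ} (hr₁ : r₁ ∈ B.zeroSpaceᗮ) (hrf₁ : ∀ e, r₁ e = B.emb f₁ e)
    (hext₁ : G.IsExtension q (Ω₁.indicator 1) u₁)
    (hu₁ : ∀ e, EqOn (G.onEdge u₁ e) (B.interp f₁ e) (Icc 0 (G.len e)))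
    (hφ₂ : G.IsTestFunction Ω₂ φ₂)
    (hrf₂ : ∀ e, r₂ e = B.emb f₂ e) (hext₂ : G.IsExtension q (Ω₂.indicator 1) u₂)
    (hu₂ : ∀ e, EqOn (G.onEdge u₂ e) (B.interp f₂ e) (Icc 0 (G.len e))) :
    G.IsDNValue q (Ω₁.indicator 1) Ω₂ (inner ℝ r₁ r₂) := by
  refine ⟨⟨u₁, hext₁, fun v hv => hv.unique hcompact hq0 hne hext₁⟩, ⟨φ₂, hφ₂⟩, ?_⟩
  intro u φ hu hφ
  obtain rfl := hu.unique hcompact hq0 hne hext₁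
  refine ⟨integrableOnGraph_mulL hcompact hq hu.1 hφ.1, ?_⟩
  -- Each test function has its own decomposition, but by uniqueness of the extension its harmonic
  -- part is always `r₂`. The remainder `p - r₂` lies in `zeroSpace`, to which `r₁` is orthogonal.
  obtain ⟨r, p, f, v, -, hrf, hpr, hpe, hext, hv⟩ := B.exists_isExtension hcompact hq hq0 hne hφ.1
  have hbd : (fun z : G.boundary => φ z) = Ω₂.indicator 1 := by
    ext z
    by_cases hz : z ∈ Ω₂
    · rw [hφ.2.1 z hz, indicator_of_mem hz, Pi.one_apply]
    · rw [hφ.2.2 z hz, indicator_of_notMem hz]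
  rw [hbd] at hext
  obtain rfl := hext.unique hcompact hq0 hne hext₂
  have hrr : r = r₂ := by
    ext1
    funext e
    have h0 : f (G.src e) = f₂ (G.src e) := by
      have hm := left_mem_Icc.2 (G.len_pos e).le
      rw [← B.interp_zero f, ← B.interp_zero f₂, ← hv e hm, ← hu₂ e hm]
    have h1 : f (G.tgt e) = f₂ (G.tgt e) := by
      have hm := right_mem_Icc.2 (G.len_pos e).le
      rw [← B.interp_len f, ← B.interp_len f₂, ← hv e hm, ← hu₂ e hm]
    rw [hrf, hrf₂, emb, emb, h0, h1]
  rw [B.graphIntegral_mulL hrf₁ hu₁ hφ.1 hpe, ← hrr, ← sub_eq_zero, ← inner_sub_right,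
    real_inner_comm]
  exact hr₁ _ hpr

end SolBasis

theorem IsDNValue.dn_eq {U : G.boundary → ℝ} {Ω : Set G.boundary} {c : ℝ}
    (h : G.IsDNValue q U Ω c) : G.DN q U Ω = c := by
  have hd : G.DNDefined q U Ω := ⟨c, h⟩
  obtain ⟨⟨u, hu, -⟩, ⟨φ, hφ⟩, hc⟩ := h
  rw [DN, dif_pos hd, ← (hc u φ hu hφ).2]
  exact ((hd.choose_spec.2.2 u φ hu hφ).2).symm

end MetricGraph

/-! ### Symmetry of the Dirichlet-Neumann function. -/

theorem mainTheorem5 {V : Type*} [Countable V] (G : MetricGraph V)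
    (hcompact : CompactSpace G.Compl) (hweak : G.WeaklyConnected)
    (q : G.Edge → ℝ → ℝ)
    (hq_nonneg : ∀ e, ∀ t ∈ Ioo 0 (G.len e), 0 ≤ q e t)
    (hq_int : G.IntegrableOnGraph q)
    (hq_weight : ∃ ω : G.Edge → ℝ, (∀ e, 0 < ω e) ∧ Summable ω ∧
      G.IntegrableOnGraph fun e t => ((ω e)⁻¹ * q e t) ^ 2 * ω e)
    (Ω₁ Ω₂ : Set G.boundary)
    (hΩ₁ : IsClopen Ω₁) (hΩ₁_ne : Ω₁.Nonempty) (hΩ₂ : IsClopen Ω₂) (hΩ₂_ne : Ω₂.Nonempty) :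
    G.DNDefined q (Ω₁.indicator 1) Ω₂ ∧ G.DNDefined q (Ω₂.indicator 1) Ω₁ ∧
      G.DN q (Ω₁.indicator 1) Ω₂ = G.DN q (Ω₂.indicator 1) Ω₁ := by
  have hne : G.boundary.Nonempty := hΩ₁_ne.elim fun z _ => ⟨z, z.2⟩
  obtain ⟨B⟩ := MetricGraph.nonempty_solBasis hq_int.1 hq_nonneg
  have key : ∀ Ω : Set G.boundary, IsClopen Ω → ∃ (φ : G.Compl → ℝ) (r : G.EnergySpace) (f : V → ℝ)
      (u : G.Compl → ℝ), G.IsTestFunction Ω φ ∧ r ∈ B.zeroSpaceᗮ ∧ (∀ e, r e = B.emb f e) ∧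
      G.IsExtension q (Ω.indicator 1) u ∧
      ∀ e, EqOn (G.onEdge u e) (B.interp f e) (Icc 0 (G.len e)) := by
    intro Ω hΩ
    obtain ⟨φ, hφ⟩ := MetricGraph.exists_isTestFunction hcompact hweak hΩ
    obtain ⟨r, p, f, u, hr, hrf, -, -, hext, hu⟩ :=
      B.exists_isExtension hcompact hq_int hq_nonneg hne hφ.1
    refine ⟨φ, r, f, u, hφ, hr, hrf, ⟨hext.1, fun z => ?_⟩, hu⟩
    refine (hext.2 z).trans ?_
    change φ z = _
    by_cases hz : z ∈ Ω
    · rw [hφ.2.1 z hz, indicator_of_mem hz, Pi.one_apply]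
    · rw [hφ.2.2 z hz, indicator_of_notMem hz]
  obtain ⟨φ₁, r₁, f₁, u₁, hφ₁, hr₁, hrf₁, hext₁, hu₁⟩ := key Ω₁ hΩ₁
  obtain ⟨φ₂, r₂, f₂, u₂, hφ₂, hr₂, hrf₂, hext₂, hu₂⟩ := key Ω₂ hΩ₂
  -- The two values are `⟨r₁, r₂⟩` and `⟨r₂, r₁⟩`.
  have h₁₂ := B.isDNValue_inner hcompact hq_int hq_nonneg hne hr₁ hrf₁ hext₁ hu₁ hφ₂ hrf₂ hext₂ hu₂
  have h₂₁ := B.isDNValue_inner hcompact hq_int hq_nonneg hne hr₂ hrf₂ hext₂ hu₂ hφ₁ hrf₁ hext₁ hu₁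
  exact ⟨⟨_, h₁₂⟩, ⟨_, h₂₁⟩, by rw [h₁₂.dn_eq, h₂₁.dn_eq, real_inner_comm]⟩
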